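/- Let $\psi\in\mathbb{C}\setminus\{0\}$ and let $u:\mathbb{R}\to\mathbb{R}$ be a non-constant $C^2$ solution of the Gauss equation $\tfrac14u''+e^{u}-|\psi|^2e^{-2u}=0$ with $u'(0)=0$ (so $2e^{u}|dz|^2$, $u=u(y)$, $z=x+iy$, and $\psi\,dz^3$ are the metric and the cubic differential of a non-flat translationally equivariant minimal Lagrangian surface in $\mathbb{C}P^2$). Let $\beta$ be the constant value of $2e^{u}+|\psi|^2e^{-2u}+\tfrac14(u')^2$ and assume that $e^{u(0)}$ is the largest root of $8w^3-4\beta w^2+4|\psi|^2=0$. Put $g_2=\tfrac43\beta^2$, $g_3=16|\psi|^2-\tfrac8{27}\beta^3$, let $\wp,\zeta$ be the Weierstrass functions with invariants $g_2,g_3$, whose period lattice $\Lambda$ is generated by $2\omega>0$ and $2\omega'\in i\mathbb{R}_{>0}$, and let $\eta=\zeta(\omega)$. For $|\lambda|=1$ let $i d_1,i d_2,i d_3$ ($d_j\in\mathbb{R}$) be the eigenvalues of $$D(\lambda)=\begin{pmatrix}0&-i\lambda\bar\psi e^{-u(0)}&i\lambda^{-1}e^{u(0)/2}\\-i\lambda^{-1}\psi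 e^{-u(0)}&0&i\lambda e^{u(0)/2}\\ i\lambda e^{u(0)/2}&i\lambda^{-1}e^{u(0)/2}&0\end{pmatrix}$$ and set $$\beta_1(y)=\int_0^y\frac{2i\lambda^3\bar\psi-iu'e^u}{\lambda^3\bar\psi-\lambda^{-3}\psi-e^uu'}\,ds,\quad \beta_2(y)=\int_0^y\frac{2e^u}{\lambda^3\bar\psi-\lambda^{-3}\psi-e^uu'}\,ds,\quad G_j(y)=\int_0^y\frac{d_j\,\mathrm{Im}(\lambda^{-3}\psi)}{d_je^u-\mathrm{Re}(\lambda^{-3}\psi)}\,ds.$$ (a) Suppose $\mathrm{Im}(\lambda^{-3}\psi)\ne0$ and $\mathrm{Re}(\lambda^{-3}\psi)\neq0$. Then the cubic $4x^3-g_2x-\tilde g_3$, $\tilde g_3=g_3-16[\mathrm{Im}(\lambda^{-3}\psi)]^2$, has three distinct real roots $\tilde e_1>\tilde e_2>\tilde e_3$, and the $d_j$ can be numbered such that $\tilde e_j=\tfrac\beta3+d_kd_l$ for $\{j,k,l\}=\{1,2,3\}$. For each $j$ there is $\alpha_j\in\mathbb{C}\setminus\Lambda$ with $|\mathrm{Im}\,\alpha_j|<\mathrm{Im}\,\omega'$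 and $\wp(\alpha_j)=\tilde e_j$. The integrands of $\beta_1,\beta_2,G_j$ are integrable on $[0,2\omega]$, and for every such choice of $\alpha_1,\alpha_2,\alpha_3$ one has $\wp'(\alpha_j)\ne0$ and, with $\tilde H_j^2=(\tilde e_j-\tilde e_k)(\tilde e_j-\tilde e_l)$, $$\beta_1(2\omega)=2\omega i-4\,\mathrm{Im}(\lambda^{-3}\psi)\,\mathrm{Re}(\lambda^{-3}\psi)\sum_{j=1}^3\frac1{\tilde H_j^2}\,\frac{4\omega\zeta(\alpha_j)-4\alpha_j\eta}{\wp'(\alpha_j)},$$ $$\beta_2(2\omega)=2i\,\mathrm{Im}(\lambda^{-3}\psi)\sum_{j=1}^3\frac{\frac\beta3-\tilde e_j}{\tilde H_j^2}\,\frac{4\omega\zeta(\alpha_j)-4\alpha_j\eta}{\wp'(\alpha_j)},$$ $$G_j(2\omega)=-2\,\mathrm{Im}(\lambda^{-3}\psi)\,\frac{4\omega\zeta(\alpha_j)-4\alpha_j\eta}{\wp'(\alpha_j)}\qquad(j=1,2,3).$$ (b) Suppose $\lambda^{-3}\psi$ is real. Then $G_j(2\omega)=0$ for $j=1,2,3$,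 and $\beta_1(2\omega)=2\omega i$, $\beta_2(2\omega)=0$, where the integrals for $\beta_1(2\omega)$ and $\beta_2(2\omega)$, whose integrands are singular at the zeros of $u'$ in $[0,2\omega]$, are Cauchy principal values: limits as $\varepsilon\to0^+$ of the integrals over the points of $[0,2\omega]$ at distance at least $\varepsilon$ from these zeros. -/

import Mathlib

open scoped Topology

/-- The Weierstrass zeta function
`ζ(z) = 1/z + ∑_{l ≠ 0} (1/(z - l) + 1/l + z/l²)` of the lattice of `L`. The summand at `l = 0`
is `1/z`, because division by zero gives zero. -/
noncomputable def PeriodPair.weierstrassZeta (L : PeriodPair) (z : ℂ) : ℂ :=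
  ∑' l : L.lattice, (1 / (z - l) + 1 / (l : ℂ) + z / (l : ℂ) ^ 2)

/-- The metric data of a translationally equivariant minimal Lagrangian surface in `ℂP²`:
the metric is `2 e^u dz dz̄` with `u = u(y)`, `z = x + i y`, the cubic Hopf differential is `ψ dz³`
with a constant `ψ ≠ 0`, the surface is not flat (`u` is not constant), `β` is the value of the
first integral of the Gauss equation, and the origin is chosen such that `u'(0) = 0` and `e^{u(0)}`
is the largest root of `8 w³ - 4 β w² + 4 |ψ|² = 0`. -/
structure IsEquivariantMetric (u : ℝ → ℝ) (ψ : ℂ) (β : ℝ) : Prop where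
  hopf_ne_zero : ψ ≠ 0
  contDiff : ContDiff ℝ 2 u
  gauss : ∀ y, (1 / 4) * deriv (deriv u) y + Real.exp (u y)
    - ‖ψ‖ ^ 2 * Real.exp (-2 * u y) = 0
  first_integral : ∀ y, 2 * Real.exp (u y) + ‖ψ‖ ^ 2 * Real.exp (-2 * u y)
    + (1 / 4) * (deriv u y) ^ 2 = β
  not_constant : ¬ ∃ c, ∀ y, u y = c
  deriv_zero : deriv u 0 = 0
  largest_root : IsGreatest {w : ℝ | 8 * w ^ 3 - 4 * β * w ^ 2 + 4 * ‖ψ‖ ^ 2 = 0} (Real.exp (u 0))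

/-- The coefficient `λ⁻³ ψ` of the cubic differential in the associated family. -/
noncomputable def hopfCoeff (ψ lam : ℂ) : ℂ := (lam ^ 3)⁻¹ * ψ

/-- The matrix `D(λ)` of the generating potential `D(λ) dz`. -/
noncomputable def potentialMatrix (u : ℝ → ℝ) (ψ lam : ℂ) : Matrix (Fin 3) (Fin 3) ℂ :=
  !![0, -Complex.I * lam * (starRingEnd ℂ) ψ * Real.exp (-u 0),
        Complex.I * lam⁻¹ * Real.exp (u 0 / 2);
     -Complex.I * lam⁻¹ * ψ * Real.exp (-u 0), 0, Complex.I * lam * Real.exp (u 0 / 2);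
     Complex.I * lam * Real.exp (u 0 / 2), Complex.I * lam⁻¹ * Real.exp (u 0 / 2), 0]

/-- The common denominator `λ³ ψ̄ - λ⁻³ ψ - e^u u'` of the derivatives of `β₁` and `β₂`. -/
noncomputable def betaDenom (u : ℝ → ℝ) (ψ lam : ℂ) (s : ℝ) : ℂ :=
  lam ^ 3 * (starRingEnd ℂ) ψ - hopfCoeff ψ lam - (Real.exp (u s) * deriv u s : ℝ)

/-- The derivative of `β₁`. -/
noncomputable def betaOneIntegrand (u : ℝ → ℝ) (ψ lam : ℂ) (s : ℝ) : ℂ :=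
  (2 * Complex.I * lam ^ 3 * (starRingEnd ℂ) ψ
    - Complex.I * (deriv u s * Real.exp (u s) : ℝ)) / betaDenom u ψ lam s

/-- The derivative of `β₂`. -/
noncomputable def betaTwoIntegrand (u : ℝ → ℝ) (ψ lam : ℂ) (s : ℝ) : ℂ :=
  (2 * Real.exp (u s) : ℝ) / betaDenom u ψ lam s

/-- The derivative of `G_j`, as a function of the eigenvalue `i d = i d_j` of `D(λ)`. -/
noncomputable def phaseIntegrand (u : ℝ → ℝ) (ψ lam : ℂ) (d : ℝ) (s : ℝ) : ℝ :=
  d * (hopfCoeff ψ lam).im / (d * Real.exp (u s) - (hopfCoeff ψ lam).re)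

noncomputable def betaOne (u : ℝ → ℝ) (ψ lam : ℂ) (y : ℝ) : ℂ :=
  ∫ s in (0 : ℝ)..y, betaOneIntegrand u ψ lam s

noncomputable def betaTwo (u : ℝ → ℝ) (ψ lam : ℂ) (y : ℝ) : ℂ :=
  ∫ s in (0 : ℝ)..y, betaTwoIntegrand u ψ lam s

noncomputable def phaseG (u : ℝ → ℝ) (ψ lam : ℂ) (d : ℝ) (y : ℝ) : ℝ :=
  ∫ s in (0 : ℝ)..y, phaseIntegrand u ψ lam d s

/-- `f` has the Cauchy principal value `v` on `[a, b]` with respect to the singular set `S`: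
`f` is integrable off every `ε`-neighbourhood of `S`, and the integrals over the complements of
these neighbourhoods tend to `v` as `ε → 0+`. -/
def HasPrincipalValue (f : ℝ → ℂ) (a b : ℝ) (S : Set ℝ) (v : ℂ) : Prop :=
  (∀ ε > 0, MeasureTheory.IntegrableOn f (Set.Icc a b \ Metric.thickening ε S)) ∧
  Filter.Tendsto (fun ε : ℝ => ∫ s in Set.Icc a b \ Metric.thickening ε S, f s) (𝓝[>] 0) (𝓝 v)

/-- `H̃_j² = (ẽ_j - ẽ_k)(ẽ_j - ẽ_l)` for `{j, k, l} = {0, 1, 2}`. -/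
def rootProduct (e : Fin 3 → ℝ) (j : Fin 3) : ℝ := (e j - e (j + 1)) * (e j - e (j + 2))

/-- The quantity `(4 ω ζ(α) - 4 α η) / ℘'(α)` with `η = ζ(ω)`. -/
noncomputable def zetaTerm (L : PeriodPair) (ω : ℝ) (α : ℂ) : ℂ :=
  (4 * ω * L.weierstrassZeta α - 4 * α * L.weierstrassZeta ω) / L.derivWeierstrassP α

/-! The function `p = β/3 - 2 e^u` satisfies `p'² = 4p³ - g₂p - g₃` and `p'' = 6p² - g₂/2`. Its
initial data are `p(0) = e₃`, the smallest root of the cubic (because `e^{u(0)}` is the largest root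
of its own cubic), and `p'(0) = 0`. The function `℘(iτ + y)` with `iτ = ω'` has the same data, so
uniqueness for the differential equation gives `p(y) = ℘(iτ + y)` (`weierstrassP_eq_profile`).
Evenness and periodicity of `℘` then give `p(2ω - y) = p(y)`, under which `e^u u'` is odd.

Write `R` and `I` for the real and imaginary part of `λ⁻³ψ`. The common denominator of the
derivatives of `β₁` and `β₂` is `-2iI - e^u u'`. Its inverse is an odd function plus `2iI / ((e^u
u')² + 4I²)`, and `(e^u u')² + 4I² = ∏ (p - ẽ_j)` (`prod_profile_sub`). The odd part integrates to
zero; partial fractions reduce the rest to integrals of `1/(p - ẽ_j)`. The integrand of `G_j` is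
already `-2I/(p - ẽ_j)`.

These integrals come from `℘'(α)/(℘(z) - ℘(α)) = ζ(z - α) - ζ(z + α) + 2ζ(α)`
(`zetaDefect_eq_derivWeierstrassP`), proved by Liouville's theorem. Over one period, `∫ ζ(z + s) ds`
is affine in `z` with slope `2η` on the strip `0 < Im z < 2τ`, so the integral of `1/(℘ - ℘(α))` is
`(4ωζ(α) - 4αη)/℘'(α)`. The condition `|Im α| < τ` keeps `iτ ± α` in that strip.

With `ẽ_j = β/3 + D_j`, the `D_j` are the roots of `D³ + βD² - 4R²`, and `d_j = -2R/D_j`. At `ẽ_j`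
the cubic of `℘` equals `-16I² < 0`, so `ẽ_j` lies below `e₃` or in `(e₂, e₁)`; `℘` attains such
values on the segments from `0` to `iτ` and from `ω` to `ω + iτ`.

If `I = 0`, the denominator itself is odd, so its contribution to every symmetric truncation
vanishes; only the constant `i` in the integrand of `β₁` survives. -/

namespace PeriodPair

open Filter

/-! ### The Weierstrass zeta function and its derivative -/

/-- The Weierstrass zeta function with the summand `1/z` of the lattice point `0` removed. -/
noncomputable def weierstrassZetaExcept (L : PeriodPair) (z : ℂ) : ℂ :=
  ∑' l : L.lattice, if l.1 = 0 then 0 else (1 / (z - l) + 1 / (l : ℂ) + z / (l : ℂ) ^ 2)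

/-- The three terms combine to `s² / ((s - l) l²)`, which decays cubically and is therefore summable
over a lattice of rank two. -/
lemma norm_zeta_summand_le {r : ℝ} {s l : ℂ} (hr : 0 < r) (hs : ‖s‖ < r) (h : 2 * r ≤ ‖l‖) :
    ‖1 / (s - l) + 1 / l + s / l ^ 2‖ ≤ 2 * r ^ 2 * ‖l‖ ^ (-3 : ℝ) := by
  have hl : 0 < ‖l‖ := by linarith
  have hl0 : l ≠ 0 := norm_pos_iff.mp hl
  have hsl : ‖l‖ / 2 ≤ ‖s - l‖ := by
    rw [norm_sub_rev]
    exact .trans (by linarith) (norm_sub_norm_le l s)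
  have hsl0 : s - l ≠ 0 := norm_pos_iff.mp (by linarith)
  have : 1 / (s - l) + 1 / l + s / l ^ 2 = s ^ 2 / ((s - l) * l ^ 2) := by
    field_simp
    ring
  rw [this, norm_div, norm_mul, norm_pow, norm_pow]
  calc ‖s‖ ^ 2 / (‖s - l‖ * ‖l‖ ^ 2) ≤ r ^ 2 / (‖l‖ / 2 * ‖l‖ ^ 2) := by gcongr
    _ = 2 * r ^ 2 / ‖l‖ ^ 3 := by field
    _ = _ := by norm_cast

lemma hasSumLocallyUniformly_weierstrassZetaExcept (L : PeriodPair) :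
    HasSumLocallyUniformly
      (fun (l : L.lattice) (z : ℂ) ↦
        if l.1 = 0 then 0 else (1 / (z - l) + 1 / (l : ℂ) + z / (l : ℂ) ^ 2))
      L.weierstrassZetaExcept := by
  refine L.hasSumLocallyUniformly_aux (u := (2 * · ^ 2 * ‖·‖ ^ (-3 : ℝ))) _
    (fun _ _ ↦ (ZLattice.summable_norm_rpow _ _ (by simp; norm_num)).mul_left _) fun r hr ↦
    Filter.eventually_atTop.mpr ⟨2 * r, ?_⟩
  rintro _ h s hs l rfl
  split_ifs
  · simpa using! show 0 ≤ 2 * r ^ 2 * (‖↑l‖ ^ 3)⁻¹ by positivity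
  · exact norm_zeta_summand_le hr hs h

lemma weierstrassZetaExcept_add (L : PeriodPair) (z : ℂ) :
    L.weierstrassZetaExcept z + 1 / z = L.weierstrassZeta z := by
  trans L.weierstrassZetaExcept z + ∑' i : L.lattice, if i = (0 : L.lattice) then 1 / z else 0
  · simp
  rw [weierstrassZetaExcept, weierstrassZeta, ← Summable.tsum_add]
  · congr with w
    by_cases h : w = 0
    · simp [h]
    · simp [h]
  · exact ⟨_, L.hasSumLocallyUniformly_weierstrassZetaExcept.hasSum⟩
  · exact summable_of_hasFiniteSupport ((Set.finite_singleton (0 : L.lattice)).subset (by simp))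

lemma hasDerivAt_zeta_summand {z l : ℂ} (h : z ≠ l) :
    HasDerivAt (fun z : ℂ ↦ 1 / (z - l) + 1 / l + z / l ^ 2) (-(1 / (z - l) ^ 2 - 1 / l ^ 2)) z := by
  have h' : z - l ≠ 0 := sub_ne_zero.mpr h
  have h1 : HasDerivAt (fun z : ℂ ↦ (z - l)⁻¹) (-1 / (z - l) ^ 2) z :=
    ((hasDerivAt_id z).sub_const l).inv h'
  convert! ((h1.add_const (1 / l)).add ((hasDerivAt_id z).div_const (l ^ 2))) using 1
  · ext; simp
  · ring

lemma differentiableOn_weierstrassZetaExcept (L : PeriodPair) :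
    DifferentiableOn ℂ L.weierstrassZetaExcept (L.lattice \ {0})ᶜ := by
  refine L.hasSumLocallyUniformly_weierstrassZetaExcept.hasSumLocallyUniformlyOn.differentiableOn
    (.of_forall fun s ↦ .fun_sum fun i hi ↦ ?_) L.isOpen_compl_lattice_sdiff
  split_ifs with h
  · simp
  · refine fun z hz ↦ (hasDerivAt_zeta_summand ?_).differentiableAt.differentiableWithinAt
    rintro rfl
    exact hz ⟨i.2, h⟩

/-- Locally uniform convergence permits termwise differentiation, which produces the negated series
of `℘`. -/
lemma eqOn_deriv_weierstrassZetaExcept (L : PeriodPair) :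
    Set.EqOn (deriv L.weierstrassZetaExcept) (fun z ↦ -L.weierstrassPExcept 0 z)
      (L.lattice \ {0})ᶜ := by
  have key : ∀ l : L.lattice, ∀ z ∈ ((L.lattice : Set ℂ) \ {0})ᶜ, HasDerivAt
      (fun z ↦ if l.1 = 0 then 0 else (1 / (z - l) + 1 / (l : ℂ) + z / (l : ℂ) ^ 2))
      (-(if l.1 = 0 then 0 else (1 / (z - l) ^ 2 - 1 / (l : ℂ) ^ 2))) z := by
    intro l z hz
    split_ifs with h
    · simpa using hasDerivAt_const z (0 : ℂ)
    · exact hasDerivAt_zeta_summand (by rintro rfl; exact hz ⟨l.2, h⟩)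
  refine (L.hasSumLocallyUniformly_weierstrassZetaExcept.tendstoLocallyUniformlyOn.deriv
    (.of_forall fun s ↦ .fun_sum fun i hi z hz ↦
      (key i z hz).differentiableAt.differentiableWithinAt) L.isOpen_compl_lattice_sdiff).unique ?_
  have h1 := (L.hasSumLocallyUniformly_weierstrassPExcept 0).tendstoLocallyUniformlyOn
    (s := ((L.lattice : Set ℂ) \ {0})ᶜ)
  refine (show TendstoLocallyUniformlyOn _ (fun z ↦ -L.weierstrassPExcept 0 z) atTop _ from
    h1.neg).congr ?_
  intro s z hz
  simp only [Function.comp_apply]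
  rw [deriv_fun_sum fun i _ ↦ (key i z hz).differentiableAt]
  simp only [(key _ z hz).deriv, Finset.sum_neg_distrib, Pi.neg_apply]

lemma hasDerivAt_weierstrassZetaExcept (L : PeriodPair) {z : ℂ} (hz : z ∉ (L.lattice : Set ℂ) \ {0}) :
    HasDerivAt L.weierstrassZetaExcept (-L.weierstrassPExcept 0 z) z := by
  have h := (L.differentiableOn_weierstrassZetaExcept.differentiableAt
    (L.isOpen_compl_lattice_sdiff.mem_nhds hz)).hasDerivAt
  rwa [L.eqOn_deriv_weierstrassZetaExcept hz] at h

lemma hasDerivAt_weierstrassZeta (L : PeriodPair) {z : ℂ} (hz : z ∉ L.lattice) :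
    HasDerivAt L.weierstrassZeta (-L.weierstrassP z) z := by
  have hz0 : z ≠ 0 := by rintro rfl; exact hz (zero_mem _)
  have h := (L.hasDerivAt_weierstrassZetaExcept (z := z) (fun h ↦ hz h.1)).add (hasDerivAt_inv hz0)
  convert! h using 1
  · ext w; simp [← L.weierstrassZetaExcept_add w]
  · have := L.weierstrassPExcept_add 0 z
    simp at this
    rw [← this]; ring

lemma analyticAt_weierstrassZeta (L : PeriodPair) {z : ℂ} (hz : z ∉ L.lattice) :
    AnalyticAt ℂ L.weierstrassZeta z :=
  (show DifferentiableOn ℂ L.weierstrassZeta (L.lattice : Set ℂ)ᶜ from fun _ hw ↦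
    (L.hasDerivAt_weierstrassZeta hw).differentiableAt.differentiableWithinAt).analyticAt
    (L.isClosed_lattice.isOpen_compl.mem_nhds hz)

lemma analyticAt_weierstrassZetaExcept (L : PeriodPair) :
    AnalyticAt ℂ L.weierstrassZetaExcept 0 :=
  L.differentiableOn_weierstrassZetaExcept.analyticAt
    (L.isOpen_compl_lattice_sdiff.mem_nhds (by simp))

@[simp]
lemma weierstrassZeta_neg (L : PeriodPair) (z : ℂ) :
    L.weierstrassZeta (-z) = -L.weierstrassZeta z := by
  simp only [weierstrassZeta]
  rw [← (Equiv.neg L.lattice).tsum_eq, ← tsum_neg]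
  congr with l
  have : -z - -(l : ℂ) = -(z - l) := by ring
  simp only [Equiv.neg_apply, NegMemClass.coe_neg, this, one_div, inv_neg]
  ring

/-! ### Quasi-periodicity of `ζ` and the second-order equation of `℘` -/

lemma isPreconnected_compl_lattice (L : PeriodPair) : IsPreconnected (L.lattice : Set ℂ)ᶜ := by
  have : Countable L.lattice := L.latticeEquivProd.toEquiv.countable_iff.mpr inferInstance
  exact (Set.Countable.isPathConnected_compl_of_one_lt_rank (by simp)
    (Set.countable_coe_iff.mp this)).isConnected.isPreconnected

lemma exists_weierstrassZeta_add_coe (L : PeriodPair) {l : ℂ} (hl : l ∈ L.lattice) :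
    ∃ c, ∀ z ∉ L.lattice, L.weierstrassZeta (z + l) = L.weierstrassZeta z + c := by
  have hd : ∀ z ∈ (L.lattice : Set ℂ)ᶜ,
      HasDerivAt (fun z ↦ L.weierstrassZeta (z + l) - L.weierstrassZeta z) 0 z := by
    intro z hz
    have hz' : z + l ∉ L.lattice := fun h ↦ hz (by simpa using sub_mem h hl)
    convert! ((L.hasDerivAt_weierstrassZeta hz').comp_add_const z l).sub
      (L.hasDerivAt_weierstrassZeta hz) using 1
    rw [L.weierstrassP_add_coe z ⟨l, hl⟩]
    ring
  obtain ⟨c, hc⟩ := L.isClosed_lattice.isOpen_compl.exists_is_const_of_deriv_eq_zero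
    L.isPreconnected_compl_lattice
    (fun z hz ↦ (hd z hz).differentiableAt.differentiableWithinAt) (fun z hz ↦ (hd z hz).deriv)
  exact ⟨c, fun z hz ↦ by rw [← hc z hz]; ring⟩

lemma weierstrassZeta_add_ω₁ (L : PeriodPair) {z : ℂ} (hz : z ∉ L.lattice) :
    L.weierstrassZeta (z + L.ω₁) = L.weierstrassZeta z + 2 * L.weierstrassZeta (L.ω₁ / 2) := by
  obtain ⟨c, hc⟩ := L.exists_weierstrassZeta_add_coe L.ω₁_mem_lattice
  -- The point `-ω₁/2` is moved to `ω₁/2`, so oddness of `ζ` determines the constant.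
  have h := hc (-(L.ω₁ / 2)) (fun h ↦ L.ω₁_div_two_notMem_lattice (by simpa using neg_mem h))
  rw [show -(L.ω₁ / 2) + L.ω₁ = L.ω₁ / 2 by ring, weierstrassZeta_neg] at h
  rw [hc z hz, two_mul, ← sub_eq_iff_eq_add'.mpr h]
  ring

lemma tendsto_weierstrassP_zero (L : PeriodPair) :
    Tendsto L.weierstrassP (𝓝[≠] 0) (Bornology.cobounded ℂ) := by
  exact tendsto_cobounded_of_meromorphicOrderAt_neg (by
    rw [L.order_weierstrassP 0 (zero_mem _)]; decide)

lemma hasDerivAt_weierstrassP (L : PeriodPair) {z : ℂ} (hz : z ∉ L.lattice) :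
    HasDerivAt L.weierstrassP (L.derivWeierstrassP z) z := by
  have := (L.analyticOnNhd_weierstrassP z hz).differentiableAt.hasDerivAt
  rwa [L.deriv_weierstrassP] at this

/-- Otherwise the identity theorem makes `℘'` vanish off the lattice, and `℘` is constant there,
against its pole at `0`. -/
lemma eventually_derivWeierstrassP_ne_zero (L : PeriodPair) {z : ℂ} (hz : z ∉ L.lattice) :
    ∀ᶠ w in 𝓝[≠] z, L.derivWeierstrassP w ≠ 0 := by
  refine (L.analyticOnNhd_derivWeierstrassP z hz).eventually_eq_zero_or_eventually_ne_zero.resolve_left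
    fun h ↦ ?_
  have h0 := L.analyticOnNhd_derivWeierstrassP.eqOn_zero_of_preconnected_of_eventuallyEq_zero
    L.isPreconnected_compl_lattice hz h
  obtain ⟨c, hc⟩ := L.isClosed_lattice.isOpen_compl.exists_is_const_of_deriv_eq_zero
    L.isPreconnected_compl_lattice
    (fun z hz ↦ (L.hasDerivAt_weierstrassP hz).differentiableAt.differentiableWithinAt)
    (fun z hz ↦ by rw [L.deriv_weierstrassP]; exact h0 hz)
  have h1 : ∀ᶠ w in 𝓝[≠] (0 : ℂ), L.weierstrassP w = c := by
    have : ((L.lattice : Set ℂ) \ {0})ᶜ ∈ 𝓝 (0 : ℂ) := L.compl_lattice_sdiff_singleton_mem_nhds 0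
    filter_upwards [nhdsWithin_le_nhds this, self_mem_nhdsWithin] with w hw hw0
    exact hc w fun h ↦ hw ⟨h, hw0⟩
  have h2 := (tendsto_congr' h1).mp L.tendsto_weierstrassP_zero
  exact not_tendsto_nhds_of_tendsto_atTop (tendsto_norm_cobounded_atTop.comp h2) ‖c‖
    tendsto_const_nhds

/-- Differentiating `℘'² = 4℘³ - g₂℘ - g₃` gives the claim multiplied by `2℘'`. The factor cancels
on a punctured neighbourhood, and continuity covers the centre. -/
lemma hasDerivAt_derivWeierstrassP (L : PeriodPair) {z : ℂ} (hz : z ∉ L.lattice) :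
    HasDerivAt L.derivWeierstrassP (6 * L.weierstrassP z ^ 2 - L.g₂ / 2) z := by
  have hopen := L.isClosed_lattice.isOpen_compl
  have ha : ∀ w ∉ L.lattice, HasDerivAt L.derivWeierstrassP (deriv L.derivWeierstrassP w) w :=
    fun w hw ↦ (L.analyticOnNhd_derivWeierstrassP w hw).differentiableAt.hasDerivAt
  have h1 : ∀ w ∉ L.lattice, 2 * L.derivWeierstrassP w *
      (deriv L.derivWeierstrassP w - (6 * L.weierstrassP w ^ 2 - L.g₂ / 2)) = 0 := by
    intro w hw
    have hl := (ha w hw).pow 2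
    have hp := L.hasDerivAt_weierstrassP hw
    have hr := (((hp.pow 3).const_mul 4).sub (hp.const_mul L.g₂)).sub_const L.g₃
    have he : (L.derivWeierstrassP ^ 2) =ᶠ[𝓝 w]
        fun w ↦ 4 * L.weierstrassP w ^ 3 - L.g₂ * L.weierstrassP w - L.g₃ := by
      filter_upwards [hopen.mem_nhds hw] with x hx using L.derivWeierstrassP_sq x hx
    have := hl.unique (hr.congr_of_eventuallyEq he)
    push_cast at this
    linear_combination this
  have hc : ContinuousAt (fun w ↦ deriv L.derivWeierstrassP w -
      (6 * L.weierstrassP w ^ 2 - L.g₂ / 2)) z := by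
    have h2 := (L.analyticOnNhd_derivWeierstrassP z hz).deriv.continuousAt
    have h3 := (L.analyticOnNhd_weierstrassP z hz).continuousAt
    fun_prop
  have h4 : ∀ᶠ w in 𝓝[≠] z, deriv L.derivWeierstrassP w -
      (6 * L.weierstrassP w ^ 2 - L.g₂ / 2) = 0 := by
    filter_upwards [nhdsWithin_le_nhds (hopen.mem_nhds hz),
      L.eventually_derivWeierstrassP_ne_zero hz] with w hw hw'
    simpa [hw'] using h1 w hw
  have h5 := tendsto_nhds_unique (hc.tendsto.mono_left nhdsWithin_le_nhds)
    ((tendsto_congr' h4).mpr tendsto_const_nhds)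
  rw [← sub_eq_zero.mp h5]
  exact ha z hz

/-! ### The addition formula for `ζ` by Liouville's theorem -/

/-- A doubly periodic function that has a removable singularity at every point is constant. -/
lemma exists_eq_const_of_removable (L : PeriodPair) (f : ℂ → ℂ)
    (hf : ∀ x, ∃ g : ℂ → ℂ, AnalyticAt ℂ g x ∧ f =ᶠ[𝓝[≠] x] g)
    (hp : ∀ l ∈ L.lattice, ∀ x, ∀ᶠ y in 𝓝[≠] x, f (y + l) = f y) :
    ∃ c, ∀ x, ContinuousAt f x → f x = c := by
  choose g hg hfg using hf
  -- `F` replaces each value of `f` by its limit. It is entire and doubly periodic, hence bounded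
  -- and constant. The value of `f` itself may be arbitrary at a singularity, so only its continuity
  -- points are claimed.
  let F : ℂ → ℂ := fun x ↦ g x x
  have hlim : ∀ x, Tendsto f (𝓝[≠] x) (𝓝 (F x)) := fun x ↦
    (tendsto_congr' (hfg x)).mpr ((hg x).continuousAt.tendsto.mono_left nhdsWithin_le_nhds)
  have hF : ∀ x, AnalyticAt ℂ F x := by
    intro x
    refine (hg x).congr ?_
    have h1 := (eventually_nhdsWithin_iff.mp (hfg x)).eventually_nhds
    filter_upwards [h1, (hg x).eventually_analyticAt] with y hy hgy
    by_cases hyx : y = x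
    · rw [hyx]
    have h2 : f =ᶠ[𝓝[≠] y] g x := by
      filter_upwards [nhdsWithin_le_nhds hy,
        nhdsWithin_le_nhds (isOpen_ne.mem_nhds hyx)] with w hw hwx using hw hwx
    exact tendsto_nhds_unique ((tendsto_congr' h2).mpr
      (hgy.continuousAt.tendsto.mono_left nhdsWithin_le_nhds)) (hlim y)
  have hper : ∀ x, ∀ l ∈ L.lattice, F (x + l) = F x := by
    intro x l hl
    have h1 : Tendsto (fun y ↦ y + l) (𝓝[≠] x) (𝓝[≠] (x + l)) := by
      refine tendsto_nhdsWithin_iff.mpr ⟨?_, ?_⟩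
      · exact (continuous_add_const l).continuousAt.tendsto.mono_left nhdsWithin_le_nhds
      · filter_upwards [self_mem_nhdsWithin] with y hy
        simpa using hy
    exact tendsto_nhds_unique ((hlim (x + l)).comp h1)
      ((tendsto_congr' (hp l hl x)).mpr (hlim x))
  have hd : Differentiable ℂ F := fun x ↦ (hF x).differentiableAt
  refine ⟨F 0, fun x hx ↦ ?_⟩
  rw [tendsto_nhds_unique (hx.tendsto.mono_left nhdsWithin_le_nhds) (hlim x)]
  exact hd.apply_eq_apply_of_bounded (IsZLattice.isCompact_range_of_periodic L.lattice _
    hd.continuous fun z w hw ↦ hper z w hw).isBounded x 0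

lemma eventually_notMem_lattice (L : PeriodPair) (x : ℂ) : ∀ᶠ y in 𝓝[≠] x, y ∉ L.lattice := by
  filter_upwards [nhdsWithin_le_nhds (L.compl_lattice_sdiff_singleton_mem_nhds x),
    self_mem_nhdsWithin] with y hy hyx h using hy ⟨h, hyx⟩

lemma eventually_add_notMem_lattice (L : PeriodPair) (x a : ℂ) :
    ∀ᶠ y in 𝓝[≠] x, y + a ∉ L.lattice := by
  have h1 : Tendsto (fun y ↦ y + a) (𝓝[≠] x) (𝓝[≠] (x + a)) := by
    refine tendsto_nhdsWithin_iff.mpr ⟨?_, ?_⟩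
    · exact (continuous_add_const a).continuousAt.tendsto.mono_left nhdsWithin_le_nhds
    · filter_upwards [self_mem_nhdsWithin] with y hy
      simpa using hy
  exact h1.eventually (L.eventually_notMem_lattice _)

lemma derivWeierstrassP_eq_zero_of_two_mul_mem (L : PeriodPair) {a : ℂ}
    (h : 2 * a ∈ L.lattice) : L.derivWeierstrassP a = 0 := by
  have h1 := L.derivWeierstrassP_sub_coe a ⟨2 * a, h⟩
  rw [show a - ((⟨2 * a, h⟩ : L.lattice) : ℂ) = -a by simp; ring, L.derivWeierstrassP_neg] at h1
  have h2 : 2 * L.derivWeierstrassP a = 0 := by linear_combination -h1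
  simpa using h2

/-- The elliptic function of the addition formula for `ζ`. -/
noncomputable def zetaDefect (L : PeriodPair) (a z : ℂ) : ℂ :=
  (L.weierstrassP z - L.weierstrassP a) *
    (L.weierstrassZeta (z - a) - L.weierstrassZeta (z + a) + 2 * L.weierstrassZeta a)

lemma zetaDefect_neg (L : PeriodPair) (a z : ℂ) : L.zetaDefect a (-z) = L.zetaDefect a z := by
  rw [zetaDefect, zetaDefect, L.weierstrassP_neg, show -z - a = -(z + a) by ring,
    show -z + a = -(z - a) by ring, L.weierstrassZeta_neg, L.weierstrassZeta_neg]
  ring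

lemma zetaDefect_add (L : PeriodPair) (a : ℂ) {l z : ℂ} (hl : l ∈ L.lattice)
    (h₁ : z - a ∉ L.lattice) (h₂ : z + a ∉ L.lattice) :
    L.zetaDefect a (z + l) = L.zetaDefect a z := by
  obtain ⟨c, hc⟩ := L.exists_weierstrassZeta_add_coe hl
  rw [zetaDefect, zetaDefect, show z + l - a = z - a + l by ring,
    show z + l + a = z + a + l by ring, hc _ h₁, hc _ h₂, L.weierstrassP_add_coe z ⟨l, hl⟩]
  ring

lemma eventually_zetaDefect_add (L : PeriodPair) (a : ℂ) {l : ℂ} (hl : l ∈ L.lattice) (x : ℂ) :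
    ∀ᶠ y in 𝓝[≠] x, L.zetaDefect a (y + l) = L.zetaDefect a y := by
  filter_upwards [L.eventually_add_notMem_lattice x a, L.eventually_add_notMem_lattice x (-a)]
    with y h₂ h₁
  exact L.zetaDefect_add a hl (by rwa [sub_eq_add_neg]) h₂

lemma analyticAt_zetaDefect (L : PeriodPair) {a z : ℂ} (hz : z ∉ L.lattice)
    (h₁ : z - a ∉ L.lattice) (h₂ : z + a ∉ L.lattice) : AnalyticAt ℂ (L.zetaDefect a) z := by
  have h3 := L.analyticOnNhd_weierstrassP z hz
  have h4 : AnalyticAt ℂ (fun z ↦ L.weierstrassZeta (z - a)) z :=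
    (L.analyticAt_weierstrassZeta h₁).comp_of_eq (by fun_prop) rfl
  have h5 : AnalyticAt ℂ (fun z ↦ L.weierstrassZeta (z + a)) z :=
    (L.analyticAt_weierstrassZeta h₂).comp_of_eq (by fun_prop) rfl
  unfold zetaDefect
  fun_prop

/-- The double pole of `℘` at `0` is cancelled by a double zero of the second factor: its value
vanishes since `ζ` is odd, its derivative since `℘` is even. -/
lemma exists_analyticAt_zetaDefect_zero (L : PeriodPair) {a : ℂ} (ha : a ∉ L.lattice) :
    ∃ g : ℂ → ℂ, AnalyticAt ℂ g 0 ∧ L.zetaDefect a =ᶠ[𝓝[≠] 0] g := by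
  have hna : -a ∉ L.lattice := fun h ↦ ha (by simpa using neg_mem h)
  set Ψ : ℂ → ℂ := fun z ↦
    L.weierstrassZeta (z - a) - L.weierstrassZeta (z + a) + 2 * L.weierstrassZeta a with hΨ
  have h4 : AnalyticAt ℂ (fun z ↦ L.weierstrassZeta (z - a)) 0 :=
    (L.analyticAt_weierstrassZeta (z := 0 - a) (by simpa)).comp_of_eq (by fun_prop) rfl
  have h5 : AnalyticAt ℂ (fun z ↦ L.weierstrassZeta (z + a)) 0 :=
    (L.analyticAt_weierstrassZeta (z := 0 + a) (by simpa)).comp_of_eq (by fun_prop) rfl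
  have hA : AnalyticAt ℂ Ψ 0 := by fun_prop
  have h0 : Ψ 0 = 0 := by simp [hΨ]; ring
  have h1 : deriv Ψ 0 = 0 := by
    have d1 : HasDerivAt (fun z ↦ L.weierstrassZeta (z - a)) (-L.weierstrassP (0 - a)) 0 :=
      (L.hasDerivAt_weierstrassZeta (z := 0 - a) (by simpa)).comp_sub_const 0 a
    have d2 : HasDerivAt (fun z ↦ L.weierstrassZeta (z + a)) (-L.weierstrassP (0 + a)) 0 :=
      (L.hasDerivAt_weierstrassZeta (z := 0 + a) (by simpa)).comp_add_const 0 a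
    have d3 : HasDerivAt Ψ (-L.weierstrassP (0 - a) - -L.weierstrassP (0 + a)) 0 :=
      (d1.sub d2).add_const _
    rw [d3.deriv]
    simp
  obtain ⟨g, hg, hg'⟩ := (natCast_le_analyticOrderAt (n := 2) hA).mp
    ((natCast_le_analyticOrderAt_iff_iteratedDeriv_eq_zero hA).mpr fun i hi ↦ by
      interval_cases i
      · simpa using h0
      · simpa using h1)
  have hP : AnalyticAt ℂ (L.weierstrassPExcept 0) 0 := L.analyticAt_weierstrassPExcept 0
  refine ⟨fun z ↦ (1 + z ^ 2 * (L.weierstrassPExcept 0 z - L.weierstrassP a)) * g z,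
    by fun_prop, ?_⟩
  filter_upwards [nhdsWithin_le_nhds hg', self_mem_nhdsWithin] with z hz hz0
  have hz0 : z ≠ 0 := hz0
  have e1 : L.zetaDefect a z = (L.weierstrassP z - L.weierstrassP a) * Ψ z := rfl
  have e2 := L.weierstrassPExcept_add 0 z
  simp only [ZeroMemClass.coe_zero, sub_zero] at e2
  rw [e1, hz, ← e2, smul_eq_mul]
  field_simp
  simp
  ring

/-- The zero of `℘(z) - ℘(a)` cancels the simple pole of `ζ(z - a)`, leaving the value `℘'(a)`.
Since `2a` is not a period, `ζ(z + a)` is regular at `a`. -/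
lemma exists_analyticAt_zetaDefect_self (L : PeriodPair) {a : ℂ} (ha : 2 * a ∉ L.lattice) :
    ∃ g : ℂ → ℂ, AnalyticAt ℂ g a ∧ g a = L.derivWeierstrassP a ∧
      L.zetaDefect a =ᶠ[𝓝[≠] a] g := by
  have ha' : a ∉ L.lattice := fun h ↦ ha (by rw [two_mul]; exact add_mem h h)
  set Q : ℂ → ℂ := fun z ↦ L.weierstrassP z - L.weierstrassP a with hQ
  have hP : AnalyticAt ℂ Q a := (L.analyticOnNhd_weierstrassP a ha').sub analyticAt_const
  have hdQ : HasDerivAt Q (L.derivWeierstrassP a) a :=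
    (L.hasDerivAt_weierstrassP ha').sub_const _
  obtain ⟨q, hq, hq'⟩ := (natCast_le_analyticOrderAt (n := 1) hP).mp
    ((natCast_le_analyticOrderAt_iff_iteratedDeriv_eq_zero hP).mpr fun i hi ↦ by
      interval_cases i
      simp [hQ])
  have hqa : q a = L.derivWeierstrassP a := by
    have d : HasDerivAt (fun z ↦ (z - a) ^ 1 • q z) (q a) a := by
      convert! (((hasDerivAt_id a).sub_const a).pow 1).mul hq.differentiableAt.hasDerivAt using 1
      simp
    exact (d.congr_of_eventuallyEq hq').unique hdQ
  have h4 : AnalyticAt ℂ (fun z ↦ L.weierstrassZetaExcept (z - a)) a :=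
    L.analyticAt_weierstrassZetaExcept.comp_of_eq (by fun_prop) (by simp)
  have h5 : AnalyticAt ℂ (fun z ↦ L.weierstrassZeta (z + a)) a :=
    (L.analyticAt_weierstrassZeta (z := a + a) (by rwa [← two_mul])).comp_of_eq (by fun_prop) rfl
  refine ⟨fun z ↦ q z * (1 + (z - a) * (L.weierstrassZetaExcept (z - a) -
    L.weierstrassZeta (z + a) + 2 * L.weierstrassZeta a)), by fun_prop, by simpa using hqa, ?_⟩
  filter_upwards [nhdsWithin_le_nhds hq', self_mem_nhdsWithin] with z hz hz0
  have hz0 : z - a ≠ 0 := sub_ne_zero.mpr hz0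
  have e1 : L.zetaDefect a z = Q z *
    (L.weierstrassZeta (z - a) - L.weierstrassZeta (z + a) + 2 * L.weierstrassZeta a) := rfl
  rw [e1, hz, ← L.weierstrassZetaExcept_add (z - a), smul_eq_mul]
  field_simp
  ring

/-- `℘'(a) / (℘(z) - ℘(a)) = ζ(z - a) - ζ(z + a) + 2 ζ(a)`, with the denominator cleared. -/
theorem zetaDefect_eq_derivWeierstrassP (L : PeriodPair) {a z : ℂ} (ha : 2 * a ∉ L.lattice)
    (hz : z ∉ L.lattice) (h₁ : z - a ∉ L.lattice) (h₂ : z + a ∉ L.lattice) :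
    L.zetaDefect a z = L.derivWeierstrassP a := by
  have ha' : a ∉ L.lattice := fun h ↦ ha (by rw [two_mul]; exact add_mem h h)
  have hself := L.exists_analyticAt_zetaDefect_self ha
  have hneg : ∃ g : ℂ → ℂ, AnalyticAt ℂ g (-a) ∧ L.zetaDefect a =ᶠ[𝓝[≠] (-a)] g := by
    obtain ⟨g, hg, -, hg'⟩ := hself
    refine ⟨fun z ↦ g (-z), hg.comp_of_eq (by fun_prop) (by simp), ?_⟩
    have ht : Tendsto (fun y : ℂ ↦ -y) (𝓝[≠] (-a)) (𝓝[≠] a) := by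
      refine tendsto_nhdsWithin_iff.mpr ⟨?_, ?_⟩
      · simpa using! (continuous_neg (G := ℂ)).continuousAt (x := -a) |>.tendsto.mono_left
          nhdsWithin_le_nhds
      · filter_upwards [self_mem_nhdsWithin] with y hy h
        exact hy (by simp [← show -y = a from h])
    filter_upwards [ht.eventually hg'] with y hy
    rw [← hy, L.zetaDefect_neg]
  have htrans : ∀ x₀ x : ℂ, x - x₀ ∈ L.lattice →
      (∃ g : ℂ → ℂ, AnalyticAt ℂ g x₀ ∧ L.zetaDefect a =ᶠ[𝓝[≠] x₀] g) →
      ∃ g : ℂ → ℂ, AnalyticAt ℂ g x ∧ L.zetaDefect a =ᶠ[𝓝[≠] x] g := by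
    rintro x₀ x hx ⟨g, hg, hg'⟩
    refine ⟨fun z ↦ g (z - (x - x₀)), hg.comp_of_eq (by fun_prop) (by simp), ?_⟩
    have ht : Tendsto (fun y : ℂ ↦ y - (x - x₀)) (𝓝[≠] x) (𝓝[≠] x₀) := by
      refine tendsto_nhdsWithin_iff.mpr ⟨?_, ?_⟩
      · have : ContinuousAt (fun y : ℂ ↦ y - (x - x₀)) x := by fun_prop
        simpa using this.tendsto.mono_left nhdsWithin_le_nhds
      · filter_upwards [self_mem_nhdsWithin] with y hy h
        have h' : y - (x - x₀) = x₀ := h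
        exact hy (show y = x by linear_combination h')
    filter_upwards [ht.eventually hg', L.eventually_zetaDefect_add a (neg_mem hx) x] with y hy hy'
    rw [← hy, ← hy', ← sub_eq_add_neg]
  -- Up to periods the only possible singularities are `0`, `a` and `-a`; evenness reduces the last
  -- to the second.
  obtain ⟨c, hc⟩ := L.exists_eq_const_of_removable (fun z ↦ L.zetaDefect a z) (fun x ↦ by
    by_cases hx : x ∈ L.lattice
    · exact htrans 0 x (by simpa) (L.exists_analyticAt_zetaDefect_zero ha')
    by_cases hx₁ : x - a ∈ L.lattice
    · obtain ⟨g, hg, -, hg'⟩ := hself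
      exact htrans a x hx₁ ⟨g, hg, hg'⟩
    by_cases hx₂ : x + a ∈ L.lattice
    · exact htrans (-a) x (by simpa) hneg
    exact ⟨_, L.analyticAt_zetaDefect hx hx₁ hx₂, .rfl⟩)
    (fun l hl x ↦ L.eventually_zetaDefect_add a hl x)
  obtain ⟨g, hg, hga, hg'⟩ := hself
  rw [hc z (L.analyticAt_zetaDefect hz h₁ h₂).continuousAt, ← hga]
  have h3 : ∀ᶠ y in 𝓝[≠] a, g y = c := by
    filter_upwards [hg', L.eventually_notMem_lattice a, L.eventually_add_notMem_lattice a a,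
      L.eventually_add_notMem_lattice a (-a)] with y hy hy0 hy2 hy1
    rw [← hy]
    exact hc y (L.analyticAt_zetaDefect hy0 (by rwa [sub_eq_add_neg]) hy2).continuousAt
  exact tendsto_nhds_unique ((tendsto_congr' h3).mpr tendsto_const_nhds)
    (hg.continuousAt.tendsto.mono_left nhdsWithin_le_nhds)

/-! ### The integral of `1/(℘ - ℘(α))` over a horizontal period -/

open MeasureTheory

lemma exists_of_mem_lattice_of_rectangular {L : PeriodPair} {ω τ : ℝ} (hL₁ : L.ω₁ = 2 * ω)
    (hL₂ : L.ω₂ = 2 * (Complex.I * τ)) {z : ℂ} (hz : z ∈ L.lattice) :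
    ∃ m n : ℤ, z.re = m * (2 * ω) ∧ z.im = n * (2 * τ) := by
  obtain ⟨m, n, rfl⟩ := mem_lattice.mp hz
  exact ⟨m, n, by simp [hL₁, hL₂], by simp [hL₁, hL₂]⟩

lemma notMem_lattice_of_im {L : PeriodPair} {ω τ : ℝ} (hτ : 0 < τ) (hL₁ : L.ω₁ = 2 * ω)
    (hL₂ : L.ω₂ = 2 * (Complex.I * τ)) {z : ℂ} (h₁ : 0 < z.im) (h₂ : z.im < 2 * τ) :
    z ∉ L.lattice := by
  intro hz
  obtain ⟨m, n, -, h⟩ := exists_of_mem_lattice_of_rectangular hL₁ hL₂ hz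
  rw [h] at h₁ h₂
  have h3 : (0 : ℝ) < n := pos_of_mul_pos_left h₁ (by positivity)
  have h4 : (n : ℝ) < 1 := by nlinarith
  norm_cast at h3 h4
  omega

lemma notMem_lattice_of_re {L : PeriodPair} {ω τ : ℝ} (hω : 0 < ω) (hL₁ : L.ω₁ = 2 * ω)
    (hL₂ : L.ω₂ = 2 * (Complex.I * τ)) {z : ℂ} (h₁ : 0 < z.re) (h₂ : z.re < 2 * ω) :
    z ∉ L.lattice := by
  intro hz
  obtain ⟨m, n, h, -⟩ := exists_of_mem_lattice_of_rectangular hL₁ hL₂ hz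
  rw [h] at h₁ h₂
  have h3 : (0 : ℝ) < m := pos_of_mul_pos_left h₁ (by positivity)
  have h4 : (m : ℝ) < 1 := by nlinarith
  norm_cast at h3 h4
  omega

lemma continuousOn_weierstrassZeta (L : PeriodPair) :
    ContinuousOn L.weierstrassZeta (L.lattice : Set ℂ)ᶜ := fun _ hz ↦
  (L.hasDerivAt_weierstrassZeta hz).continuousAt.continuousWithinAt

lemma continuousOn_weierstrassP (L : PeriodPair) :
    ContinuousOn L.weierstrassP (L.lattice : Set ℂ)ᶜ :=
  L.differentiableOn_weierstrassP.continuousOn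

lemma continuous_comp_horizontal {L : PeriodPair} {ω τ : ℝ} (hτ : 0 < τ) (hL₁ : L.ω₁ = 2 * ω)
    (hL₂ : L.ω₂ = 2 * (Complex.I * τ)) {f : ℂ → ℂ} (hf : ContinuousOn f (L.lattice : Set ℂ)ᶜ)
    {z : ℂ} (h₁ : 0 < z.im) (h₂ : z.im < 2 * τ) : Continuous fun s : ℝ ↦ f (z + s) := by
  refine hf.comp_continuous (by fun_prop) fun s ↦ ?_
  exact notMem_lattice_of_im hτ hL₁ hL₂ (by simpa) (by simpa)

/-- Differentiation under the integral gives `∫ -℘(z + s) ds = ζ(z + 2ω) - ζ(z) = 2ζ(ω)`. -/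
lemma hasDerivAt_integral_weierstrassZeta {L : PeriodPair} {ω τ : ℝ} (hτ : 0 < τ)
    (hL₁ : L.ω₁ = 2 * ω) (hL₂ : L.ω₂ = 2 * (Complex.I * τ)) {z : ℂ} (h₁ : 0 < z.im)
    (h₂ : z.im < 2 * τ) :
    HasDerivAt (fun z ↦ ∫ s in (0 : ℝ)..(2 * ω), L.weierstrassZeta (z + s))
      (2 * L.weierstrassZeta ω) z := by
  have hnot : ∀ w : ℂ, 0 < w.im → w.im < 2 * τ → w ∉ L.lattice := fun w hw hw' ↦
    notMem_lattice_of_im hτ hL₁ hL₂ hw hw'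
  have hnot' : ∀ w : ℂ, 0 < w.im → w.im < 2 * τ → ∀ s : ℝ, w + s ∉ L.lattice := fun w hw hw' s ↦
    hnot _ (by simpa) (by simpa)
  have hcont : ∀ w : ℂ, 0 < w.im → w.im < 2 * τ →
      Continuous fun s : ℝ ↦ L.weierstrassZeta (w + s) := fun w hw hw' ↦
    continuous_comp_horizontal hτ hL₁ hL₂ L.continuousOn_weierstrassZeta hw hw'
  have hcontP : ∀ w : ℂ, 0 < w.im → w.im < 2 * τ →
      Continuous fun s : ℝ ↦ L.weierstrassP (w + s) := fun w hw hw' ↦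
    continuous_comp_horizontal hτ hL₁ hL₂ L.continuousOn_weierstrassP hw hw'
  have hder : ∀ w : ℂ, 0 < w.im → w.im < 2 * τ → ∀ s : ℝ,
      HasDerivAt (fun w ↦ L.weierstrassZeta (w + s)) (-L.weierstrassP (w + s)) w :=
    fun w hw hw' s ↦ (L.hasDerivAt_weierstrassZeta (hnot' w hw hw' s)).comp_add_const w s
  have hopen : IsOpen {w : ℂ | 0 < w.im ∧ w.im < 2 * τ} :=
    (isOpen_lt continuous_const Complex.continuous_im).inter
      (isOpen_lt Complex.continuous_im continuous_const)
  obtain ⟨r, hr, hrs⟩ := Metric.isOpen_iff.mp hopen z ⟨h₁, h₂⟩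
  have hsub : Metric.closedBall z (r / 2) ⊆ {w : ℂ | 0 < w.im ∧ w.im < 2 * τ} :=
    (Metric.closedBall_subset_ball (by linarith)).trans hrs
  have hK : IsCompact (Metric.closedBall z (r / 2) ×ˢ Set.uIcc 0 (2 * ω)) :=
    (isCompact_closedBall _ _).prod isCompact_uIcc
  obtain ⟨C, hC⟩ := hK.exists_bound_of_continuousOn
    (f := fun p : ℂ × ℝ ↦ -L.weierstrassP (p.1 + p.2)) (by
      refine (L.continuousOn_weierstrassP.comp (by fun_prop) ?_).neg
      rintro ⟨w, s⟩ ⟨hw, -⟩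
      exact hnot' w (hsub hw).1 (hsub hw).2 s)
  have hball : Metric.closedBall z (r / 2) ∈ 𝓝 z := Metric.closedBall_mem_nhds z (by linarith)
  have key := intervalIntegral.hasDerivAt_integral_of_dominated_loc_of_deriv_le
    (μ := volume) (a := 0) (b := 2 * ω) (F := fun w (s : ℝ) ↦ L.weierstrassZeta (w + s))
    (F' := fun w (s : ℝ) ↦ -L.weierstrassP (w + s)) (x₀ := z) (bound := fun _ ↦ C) hball
    (by
      filter_upwards [hball] with w hw
      exact (hcont w (hsub hw).1 (hsub hw).2).aestronglyMeasurable)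
    ((hcont z h₁ h₂).intervalIntegrable _ _)
    (hcontP z h₁ h₂).neg.aestronglyMeasurable
    (.of_forall fun s hs w hw ↦ hC (w, s) ⟨hw, Set.uIoc_subset_uIcc hs⟩)
    intervalIntegrable_const
    (.of_forall fun s hs w hw ↦ hder w (hsub hw).1 (hsub hw).2 s)
  have hftc : ∫ s in (0 : ℝ)..(2 * ω), -L.weierstrassP (z + s) = 2 * L.weierstrassZeta ω := by
    rw [intervalIntegral.integral_eq_sub_of_hasDerivAt
      (f := fun s : ℝ ↦ L.weierstrassZeta (z + s))
      (f' := fun s : ℝ ↦ -L.weierstrassP (z + s)) (fun s _ ↦ ?_)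
      ((hcontP z h₁ h₂).neg.intervalIntegrable _ _)]
    · have := L.weierstrassZeta_add_ω₁ (hnot z h₁ h₂)
      rw [hL₁, mul_div_cancel_left₀ _ two_ne_zero] at this
      push_cast
      rw [this]
      simp
    · exact ((L.hasDerivAt_weierstrassZeta (hnot' z h₁ h₂ s)).comp_const_add z s).comp_ofReal
  rw [← hftc]
  exact key.2

lemma integral_weierstrassZeta_sub {L : PeriodPair} {ω τ : ℝ} (hτ : 0 < τ)
    (hL₁ : L.ω₁ = 2 * ω) (hL₂ : L.ω₂ = 2 * (Complex.I * τ)) {z w : ℂ} (hz₁ : 0 < z.im)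
    (hz₂ : z.im < 2 * τ) (hw₁ : 0 < w.im) (hw₂ : w.im < 2 * τ) :
    (∫ s in (0 : ℝ)..(2 * ω), L.weierstrassZeta (z + s)) -
      ∫ s in (0 : ℝ)..(2 * ω), L.weierstrassZeta (w + s) = 2 * L.weierstrassZeta ω * (z - w) := by
  have hopen : IsOpen {w : ℂ | 0 < w.im ∧ w.im < 2 * τ} :=
    (isOpen_lt continuous_const Complex.continuous_im).inter
      (isOpen_lt Complex.continuous_im continuous_const)
  have hconv : Convex ℝ {w : ℂ | 0 < w.im ∧ w.im < 2 * τ} :=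
    (convex_halfSpace_im_gt 0).inter (convex_halfSpace_im_lt _)
  have hd : ∀ x ∈ {w : ℂ | 0 < w.im ∧ w.im < 2 * τ}, HasDerivAt
      (fun z ↦ (∫ s in (0 : ℝ)..(2 * ω), L.weierstrassZeta (z + s)) -
        2 * L.weierstrassZeta ω * z) 0 x := by
    intro x hx
    convert! (hasDerivAt_integral_weierstrassZeta hτ hL₁ hL₂ hx.1 hx.2).sub
      ((hasDerivAt_id x).const_mul (2 * L.weierstrassZeta ω)) using 1
    ring
  have := hopen.is_const_of_deriv_eq_zero hconv.isPreconnected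
    (fun x hx ↦ (hd x hx).differentiableAt.differentiableWithinAt) (fun x hx ↦ (hd x hx).deriv)
    (show z ∈ _ from ⟨hz₁, hz₂⟩) (show w ∈ _ from ⟨hw₁, hw₂⟩)
  linear_combination this

lemma two_mul_notMem_of_derivWeierstrassP_ne_zero {L : PeriodPair} {α : ℂ}
    (h : L.derivWeierstrassP α ≠ 0) : 2 * α ∉ L.lattice :=
  fun h' ↦ h (L.derivWeierstrassP_eq_zero_of_two_mul_mem h')

lemma weierstrassP_sub_mul_zeta_horizontal {L : PeriodPair} {ω τ : ℝ} (hτ : 0 < τ)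
    (hL₁ : L.ω₁ = 2 * ω) (hL₂ : L.ω₂ = 2 * (Complex.I * τ)) {α : ℂ}
    (hα : |α.im| < τ) (hα' : L.derivWeierstrassP α ≠ 0) (s : ℝ) :
    (L.weierstrassP (Complex.I * τ + s) - L.weierstrassP α) *
      (L.weierstrassZeta (Complex.I * τ - α + s) - L.weierstrassZeta (Complex.I * τ + α + s)
        + 2 * L.weierstrassZeta α) = L.derivWeierstrassP α := by
  obtain ⟨h1, h2⟩ := abs_lt.mp hα
  rw [← L.zetaDefect_eq_derivWeierstrassP (two_mul_notMem_of_derivWeierstrassP_ne_zero hα')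
    (z := Complex.I * τ + s)]
  · rw [zetaDefect, show Complex.I * τ + s - α = Complex.I * τ - α + s by ring,
      show Complex.I * τ + s + α = Complex.I * τ + α + s by ring]
  all_goals exact notMem_lattice_of_im hτ hL₁ hL₂ (by simp; linarith) (by simp; linarith)

/-- The complete integral of `1 / (℘ - ℘(α))` along the horizontal line through `i τ`. -/
theorem integral_inv_weierstrassP_sub {L : PeriodPair} {ω τ : ℝ} (hτ : 0 < τ)
    (hL₁ : L.ω₁ = 2 * ω) (hL₂ : L.ω₂ = 2 * (Complex.I * τ)) {α : ℂ}
    (hα : |α.im| < τ) (hα' : L.derivWeierstrassP α ≠ 0) :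
    ∫ s in (0 : ℝ)..(2 * ω), (L.weierstrassP (Complex.I * τ + s) - L.weierstrassP α)⁻¹ =
      zetaTerm L ω α := by
  obtain ⟨h1, h2⟩ := abs_lt.mp hα
  have key := weierstrassP_sub_mul_zeta_horizontal hτ hL₁ hL₂ hα hα'
  have h3 : ∀ s : ℝ, (L.weierstrassP (Complex.I * τ + s) - L.weierstrassP α)⁻¹ =
      (L.derivWeierstrassP α)⁻¹ * (L.weierstrassZeta (Complex.I * τ - α + s) -
        L.weierstrassZeta (Complex.I * τ + α + s) + 2 * L.weierstrassZeta α) := by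
    intro s
    have h4 : L.weierstrassP (Complex.I * τ + s) - L.weierstrassP α ≠ 0 := by
      intro h
      have := key s
      rw [h, zero_mul] at this
      exact hα' this.symm
    rw [inv_eq_iff_eq_inv, mul_inv, inv_inv, ← key s, mul_assoc, mul_inv_cancel₀, mul_one]
    exact right_ne_zero_of_mul (by rw [key s]; exact hα')
  have hi : ∀ w : ℂ, 0 < w.im → w.im < 2 * τ → IntervalIntegrable
      (fun s : ℝ ↦ L.weierstrassZeta (w + s)) volume 0 (2 * ω) := fun w hw hw' ↦
    (continuous_comp_horizontal hτ hL₁ hL₂ L.continuousOn_weierstrassZeta hw hw').intervalIntegrable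
      _ _
  have i1 := hi (Complex.I * τ - α) (by simp; linarith) (by simp; linarith)
  have i2 := hi (Complex.I * τ + α) (by simp; linarith) (by simp; linarith)
  -- The two shifted integrals differ by `2η((iτ - α) - (iτ + α)) = -4αη`; the constant `2ζ(α)`
  -- contributes `4ωζ(α)`.
  simp_rw [h3]
  rw [intervalIntegral.integral_const_mul, intervalIntegral.integral_add (i1.sub i2)
    intervalIntegrable_const, intervalIntegral.integral_sub i1 i2,
    integral_weierstrassZeta_sub hτ hL₁ hL₂ (by simp; linarith) (by simp; linarith)
      (by simp; linarith) (by simp; linarith), intervalIntegral.integral_const, zetaTerm]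
  simp only [sub_zero, Complex.real_smul]
  push_cast
  field_simp
  ring

end PeriodPair

/-! ### Real values of `℘` for a rectangular lattice -/

/-- A continuous function that avoids a gap `(a, b)` stays on one side of the gap. -/
lemma IsPreconnected.le_of_avoids_gap {S : Set ℝ} (hS : IsPreconnected S) {f : ℝ → ℝ}
    (hf : ContinuousOn f S) {a b : ℝ} (hab : a < b) (hgap : ∀ t ∈ S, f t ≤ a ∨ b ≤ f t) {x y : ℝ}
    (hx : x ∈ S) (hy : y ∈ S) (hxa : f x ≤ a) : f y ≤ a := by
  refine (hgap y hy).resolve_right fun hyb ↦ ?_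
  obtain ⟨t, ht, htm⟩ := hS.intermediate_value hx hy hf
    (show (a + b) / 2 ∈ Set.Icc (f x) (f y) from ⟨by linarith, by linarith⟩)
  rcases hgap t ht with h | h <;> linarith

lemma IsPreconnected.ge_of_avoids_gap {S : Set ℝ} (hS : IsPreconnected S) {f : ℝ → ℝ}
    (hf : ContinuousOn f S) {a b : ℝ} (hab : a < b) (hgap : ∀ t ∈ S, f t ≤ a ∨ b ≤ f t) {x y : ℝ}
    (hx : x ∈ S) (hy : y ∈ S) (hxb : b ≤ f x) : b ≤ f y := by
  by_contra h
  have := hS.le_of_avoids_gap hf hab hgap hy hx ((hgap y hy).resolve_right h)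
  linarith

lemma cubic_nonneg_iff_gap {a b c x : ℝ} (hab : b < a) (hbc : c < b)
    (h : 0 ≤ 4 * (x - a) * (x - b) * (x - c)) : c ≤ x ∧ (x ≤ b ∨ a ≤ x) := by
  constructor
  · by_contra! hx
    have h1 : 0 < (a - x) * (b - x) * (c - x) :=
      mul_pos (mul_pos (by linarith) (by linarith)) (by linarith)
    nlinarith
  · by_contra! hx
    have h1 : 0 < (a - x) * (x - b) * (x - c) :=
      mul_pos (mul_pos (by linarith) (by linarith)) (by linarith)
    nlinarith

lemma cubic_nonpos_iff_gap {a b c x : ℝ} (hab : b < a) (hbc : c < b)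
    (h : 4 * (x - a) * (x - b) * (x - c) ≤ 0) : x ≤ a ∧ (x ≤ c ∨ b ≤ x) := by
  obtain ⟨h1, h2⟩ := cubic_nonneg_iff_gap (a := -c) (b := -b) (c := -a) (x := -x)
    (by linarith) (by linarith) (by nlinarith)
  exact ⟨by linarith, h2.symm.imp (fun h ↦ by linarith) (fun h ↦ by linarith)⟩

namespace PeriodPair

open Filter

lemma conj_mem_lattice_of_rectangular {L : PeriodPair} {ω τ : ℝ} (hL₁ : L.ω₁ = 2 * ω)
    (hL₂ : L.ω₂ = 2 * (Complex.I * τ)) {z : ℂ} (hz : z ∈ L.lattice) :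
    (starRingEnd ℂ) z ∈ L.lattice := by
  obtain ⟨m, n, rfl⟩ := mem_lattice.mp hz
  refine mem_lattice.mpr ⟨m, -n, ?_⟩
  simp [hL₁, hL₂, Complex.conj_ofNat]

lemma weierstrassP_conj_of_rectangular {L : PeriodPair} {ω τ : ℝ} (hL₁ : L.ω₁ = 2 * ω)
    (hL₂ : L.ω₂ = 2 * (Complex.I * τ)) (z : ℂ) :
    L.weierstrassP ((starRingEnd ℂ) z) = (starRingEnd ℂ) (L.weierstrassP z) := by
  let e : L.lattice ≃ L.lattice :=
    { toFun := fun l ↦ ⟨_, conj_mem_lattice_of_rectangular hL₁ hL₂ l.2⟩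
      invFun := fun l ↦ ⟨_, conj_mem_lattice_of_rectangular hL₁ hL₂ l.2⟩
      left_inv := fun l ↦ by simp
      right_inv := fun l ↦ by simp }
  rw [weierstrassP, weierstrassP, Complex.conj_tsum, ← e.tsum_eq]
  congr with l
  simp [e]

/-- `℘` commutes with conjugation, is even and is periodic, so it is real wherever the conjugate of
`z` is congruent to `z` or `-z`. -/
lemma weierstrassP_im_eq_zero {L : PeriodPair} {ω τ : ℝ} (hL₁ : L.ω₁ = 2 * ω)
    (hL₂ : L.ω₂ = 2 * (Complex.I * τ)) {z : ℂ}
    (h : (starRingEnd ℂ) z - z ∈ L.lattice ∨ (starRingEnd ℂ) z + z ∈ L.lattice) :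
    (L.weierstrassP z).im = 0 := by
  rw [← Complex.conj_eq_iff_im, ← weierstrassP_conj_of_rectangular hL₁ hL₂]
  rcases h with h | h
  · rw [← L.weierstrassP_sub_coe _ ⟨_, h⟩]
    simp
  · rw [← L.weierstrassP_sub_coe _ ⟨_, h⟩]
    simp

/-- If `℘` is real on the line `z + ℝ c`, then `c ℘'(z)` is real. -/
lemma exists_mul_derivWeierstrassP_eq_ofReal {L : PeriodPair} {z c : ℂ} (hz : z ∉ L.lattice)
    (hreal : ∀ t : ℝ, (L.weierstrassP (z + c * t)).im = 0) :
    ∃ r : ℝ, c * L.derivWeierstrassP z = r := by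
  have h1 : HasDerivAt (fun t : ℂ ↦ L.weierstrassP (z + c * t)) (L.derivWeierstrassP z * c)
      ((0 : ℝ) : ℂ) := by
    refine HasDerivAt.comp_of_eq (h₂ := L.weierstrassP) (h := fun t ↦ z + c * t) (x := _)
      (y := z) ?_ ?_ (by simp)
    · exact L.hasDerivAt_weierstrassP hz
    · simpa using ((hasDerivAt_id ((0 : ℝ) : ℂ)).const_mul c).const_add z
  have h2 := (Complex.imCLM.hasFDerivAt.comp_hasDerivAt (0 : ℝ) h1.comp_ofReal)
  have h3 : (Complex.imCLM ∘ fun t : ℝ ↦ L.weierstrassP (z + c * t)) = fun _ ↦ (0 : ℝ) := by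
    ext t; exact hreal t
  rw [h3] at h2
  have h4 := h2.unique (hasDerivAt_const _ _)
  refine ⟨(L.derivWeierstrassP z * c).re, ?_⟩
  rw [mul_comm]
  exact Complex.ext (by simp) (by simpa using h4)

lemma tendsto_weierstrassP_ofReal_zero (L : PeriodPair) :
    Tendsto (fun t : ℝ ↦ (L.weierstrassP t).re) (𝓝[>] 0) atTop := by
  have hc : Tendsto (fun t : ℝ ↦ (L.weierstrassPExcept 0 t).re) (𝓝[>] 0) (𝓝 0) := by
    have h1 : ContinuousAt (fun t : ℝ ↦ (L.weierstrassPExcept 0 t).re) 0 := by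
      refine Complex.continuous_re.continuousAt.comp (ContinuousAt.comp_of_eq (y := (0 : ℂ))
        (L.analyticAt_weierstrassPExcept 0).continuousAt
        Complex.continuous_ofReal.continuousAt (by simp))
    simpa using h1.tendsto.mono_left (nhdsWithin_le_nhds (s := Set.Ioi 0))
  have hd : Tendsto (fun t : ℝ ↦ (t ^ 2)⁻¹) (𝓝[>] 0) atTop := by
    refine tendsto_inv_nhdsGT_zero.comp (tendsto_nhdsWithin_iff.mpr ⟨?_, ?_⟩)
    · have : ContinuousAt (fun t : ℝ ↦ t ^ 2) 0 := by fun_prop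
      simpa using this.tendsto.mono_left (nhdsWithin_le_nhds (s := Set.Ioi 0))
    · filter_upwards [self_mem_nhdsWithin] with t ht
      have : 0 < t := ht
      exact Set.mem_Ioi.mpr (by positivity)
  refine (hc.add_atTop hd).congr fun t ↦ ?_
  have e := L.weierstrassPExcept_add 0 t
  simp only [ZeroMemClass.coe_zero, sub_zero] at e
  rw [← e]
  simp [← Complex.ofReal_pow, ← Complex.ofReal_inv]

lemma tendsto_weierstrassP_I_mul_zero (L : PeriodPair) :
    Tendsto (fun t : ℝ ↦ (L.weierstrassP (Complex.I * t)).re) (𝓝[>] 0) atBot := by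
  have hc : Tendsto (fun t : ℝ ↦ (L.weierstrassPExcept 0 (Complex.I * t)).re) (𝓝[>] 0) (𝓝 0) := by
    have h1 : ContinuousAt (fun t : ℝ ↦ (L.weierstrassPExcept 0 (Complex.I * t)).re) 0 := by
      refine Complex.continuous_re.continuousAt.comp (ContinuousAt.comp_of_eq (y := (0 : ℂ))
        (L.analyticAt_weierstrassPExcept 0).continuousAt
        (by fun_prop) (by simp))
    simpa using h1.tendsto.mono_left (nhdsWithin_le_nhds (s := Set.Ioi 0))
  have hd : Tendsto (fun t : ℝ ↦ (t ^ 2)⁻¹) (𝓝[>] 0) atTop := by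
    refine tendsto_inv_nhdsGT_zero.comp (tendsto_nhdsWithin_iff.mpr ⟨?_, ?_⟩)
    · have : ContinuousAt (fun t : ℝ ↦ t ^ 2) 0 := by fun_prop
      simpa using this.tendsto.mono_left (nhdsWithin_le_nhds (s := Set.Ioi 0))
    · filter_upwards [self_mem_nhdsWithin] with t ht
      have : 0 < t := ht
      exact Set.mem_Ioi.mpr (by positivity)
  refine (hc.add_atBot (tendsto_neg_atTop_atBot.comp hd)).congr fun t ↦ ?_
  have e := L.weierstrassPExcept_add 0 (Complex.I * t)
  simp only [ZeroMemClass.coe_zero, sub_zero] at e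
  rw [← e]
  simp [mul_pow, ← Complex.ofReal_pow, ← Complex.ofReal_inv, inv_neg]

/-- A rectangular lattice with real invariants whose Weierstrass cubic has the real roots
`e₁ > e₂ > e₃`. -/
structure IsRectangular (L : PeriodPair) (ω τ e₁ e₂ e₃ : ℝ) : Prop where
  pos_left : 0 < ω
  pos_right : 0 < τ
  left : L.ω₁ = 2 * ω
  right : L.ω₂ = 2 * (Complex.I * τ)
  cubic : ∀ x : ℂ, 4 * x ^ 3 - L.g₂ * x - L.g₃ = 4 * (x - e₁) * (x - e₂) * (x - e₃)
  lt₁ : e₂ < e₁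
  lt₂ : e₃ < e₂

namespace IsRectangular

variable {L : PeriodPair} {ω τ e₁ e₂ e₃ : ℝ}

/-- The square of the real number `c ℘'(z)` is nonnegative. It is used with `c = 1` on horizontal
and `c = i` on vertical lines, which gives the cubic opposite signs there. -/
lemma sq_mul_cubic (h : L.IsRectangular ω τ e₁ e₂ e₃) {z c : ℂ} (hz : z ∉ L.lattice)
    (hreal : ∀ t : ℝ, (L.weierstrassP (z + c * t)).im = 0) {k : ℝ} (hc : c ^ 2 = k) :
    0 ≤ k * (4 * ((L.weierstrassP z).re - e₁) * ((L.weierstrassP z).re - e₂) *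
      ((L.weierstrassP z).re - e₃)) := by
  obtain ⟨r, hr⟩ := exists_mul_derivWeierstrassP_eq_ofReal hz hreal
  have h0 : L.weierstrassP z = (L.weierstrassP z).re :=
    Complex.ext rfl (by simpa using hreal 0)
  have h1 := L.derivWeierstrassP_sq z hz
  rw [h.cubic, h0] at h1
  have h2 : (r : ℂ) ^ 2 = ((k * (4 * ((L.weierstrassP z).re - e₁) * ((L.weierstrassP z).re - e₂) *
      ((L.weierstrassP z).re - e₃)) : ℝ) : ℂ) := by
    push_cast
    rw [← hr, mul_pow, h1, hc]
  norm_cast at h2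
  rw [← h2]
  positivity

lemma root_of_two_mul_mem (h : L.IsRectangular ω τ e₁ e₂ e₃) {z : ℂ} (hz : z ∉ L.lattice)
    (h2z : 2 * z ∈ L.lattice) :
    L.weierstrassP z = e₁ ∨ L.weierstrassP z = e₂ ∨ L.weierstrassP z = e₃ := by
  have h1 := L.derivWeierstrassP_sq z hz
  rw [L.derivWeierstrassP_eq_zero_of_two_mul_mem h2z, h.cubic] at h1
  simpa [sub_eq_zero, or_assoc] using h1.symm

lemma mem_left (h : L.IsRectangular ω τ e₁ e₂ e₃) : (2 * ω : ℂ) ∈ L.lattice :=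
  h.left ▸ L.ω₁_mem_lattice

lemma mem_right (h : L.IsRectangular ω τ e₁ e₂ e₃) : 2 * (Complex.I * τ) ∈ L.lattice :=
  h.right ▸ L.ω₂_mem_lattice

lemma notMem_of_im (h : L.IsRectangular ω τ e₁ e₂ e₃) {z : ℂ} (h₁ : 0 < z.im)
    (h₂ : z.im < 2 * τ) : z ∉ L.lattice :=
  notMem_lattice_of_im h.pos_right h.left h.right h₁ h₂

lemma notMem_of_re (h : L.IsRectangular ω τ e₁ e₂ e₃) {z : ℂ} (h₁ : 0 < z.re)
    (h₂ : z.re < 2 * ω) : z ∉ L.lattice :=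
  notMem_lattice_of_re h.pos_left h.left h.right h₁ h₂

lemma im_eq_zero_real (h : L.IsRectangular ω τ e₁ e₂ e₃) (t : ℝ) :
    (L.weierstrassP t).im = 0 :=
  weierstrassP_im_eq_zero h.left h.right (.inl (by simp))

lemma im_eq_zero_imag (h : L.IsRectangular ω τ e₁ e₂ e₃) (t : ℝ) :
    (L.weierstrassP (Complex.I * t)).im = 0 :=
  weierstrassP_im_eq_zero h.left h.right (.inr (by simp))

lemma im_eq_zero_horizontal (h : L.IsRectangular ω τ e₁ e₂ e₃) (t : ℝ) :
    (L.weierstrassP (Complex.I * τ + t)).im = 0 := by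
  refine weierstrassP_im_eq_zero h.left h.right (.inl ?_)
  convert! neg_mem h.mem_right using 1
  simp
  ring

lemma im_eq_zero_vertical (h : L.IsRectangular ω τ e₁ e₂ e₃) (t : ℝ) :
    (L.weierstrassP (ω + Complex.I * t)).im = 0 := by
  refine weierstrassP_im_eq_zero h.left h.right (.inr ?_)
  convert! h.mem_left using 1
  simp
  ring

lemma continuousOn_re {S : Set ℝ} {f : ℝ → ℂ} (hf : Continuous f)
    (hS : ∀ t ∈ S, f t ∉ L.lattice) : ContinuousOn (fun t ↦ (L.weierstrassP (f t)).re) S :=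
  Complex.continuous_re.comp_continuousOn (L.continuousOn_weierstrassP.comp hf.continuousOn hS)

lemma cubic_nonneg_real (h : L.IsRectangular ω τ e₁ e₂ e₃) {t : ℝ} (ht : t ∈ Set.Ioo 0 (2 * ω)) :
    e₃ ≤ (L.weierstrassP t).re ∧ ((L.weierstrassP t).re ≤ e₂ ∨ e₁ ≤ (L.weierstrassP t).re) := by
  refine cubic_nonneg_iff_gap h.lt₁ h.lt₂ ?_
  simpa using h.sq_mul_cubic (z := t) (c := 1) (k := 1) (h.notMem_of_re ht.1 ht.2)
    (fun s ↦ by simpa using h.im_eq_zero_real (t + s)) (by simp)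

lemma cubic_nonpos_imag (h : L.IsRectangular ω τ e₁ e₂ e₃) {t : ℝ} (ht : t ∈ Set.Ioo 0 (2 * τ)) :
    (L.weierstrassP (Complex.I * t)).re ≤ e₁ ∧
      ((L.weierstrassP (Complex.I * t)).re ≤ e₃ ∨ e₂ ≤ (L.weierstrassP (Complex.I * t)).re) := by
  refine cubic_nonpos_iff_gap h.lt₁ h.lt₂ ?_
  have := h.sq_mul_cubic (z := Complex.I * t) (c := Complex.I) (k := -1)
    (h.notMem_of_im (by simpa using ht.1) (by simpa using ht.2))
    (fun s ↦ by simpa [mul_add] using h.im_eq_zero_imag (t + s)) (by simp)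
  linarith

lemma cubic_nonneg_horizontal (h : L.IsRectangular ω τ e₁ e₂ e₃) (t : ℝ) :
    e₃ ≤ (L.weierstrassP (Complex.I * τ + t)).re ∧
      ((L.weierstrassP (Complex.I * τ + t)).re ≤ e₂ ∨
        e₁ ≤ (L.weierstrassP (Complex.I * τ + t)).re) := by
  have hτ := h.pos_right
  refine cubic_nonneg_iff_gap h.lt₁ h.lt₂ ?_
  simpa using h.sq_mul_cubic (z := Complex.I * τ + t) (c := 1) (k := 1)
    (h.notMem_of_im (by simpa) (by simp; linarith))
    (fun s ↦ by simpa [add_assoc] using h.im_eq_zero_horizontal (t + s)) (by simp)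

lemma cubic_nonpos_vertical (h : L.IsRectangular ω τ e₁ e₂ e₃) (t : ℝ) :
    (L.weierstrassP (ω + Complex.I * t)).re ≤ e₁ ∧
      ((L.weierstrassP (ω + Complex.I * t)).re ≤ e₃ ∨
        e₂ ≤ (L.weierstrassP (ω + Complex.I * t)).re) := by
  have hω := h.pos_left
  refine cubic_nonpos_iff_gap h.lt₁ h.lt₂ ?_
  have := h.sq_mul_cubic (z := ω + Complex.I * t) (c := Complex.I) (k := -1)
    (h.notMem_of_re (by simpa) (by simp; linarith))
    (fun s ↦ by simpa [mul_add, add_assoc] using h.im_eq_zero_vertical (t + s)) (by simp)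
  linarith

/-- On `(0, 2ω)` the function `℘` avoids the gap `(e₂, e₁)` and starts at `+∞`, so it stays above
`e₁`. Its value at a half period is a root. -/
lemma weierstrassP_left (h : L.IsRectangular ω τ e₁ e₂ e₃) : L.weierstrassP ω = e₁ := by
  have hω := h.pos_left
  obtain ⟨s, hs1, hs⟩ := ((L.tendsto_weierstrassP_ofReal_zero.eventually_ge_atTop e₁).and
    (Ioo_mem_nhdsGT (show 0 < 2 * ω by linarith))).exists
  have h1 : e₁ ≤ (L.weierstrassP ω).re := isPreconnected_Ioo.ge_of_avoids_gap
    (continuousOn_re Complex.continuous_ofReal fun t ht ↦ h.notMem_of_re ht.1 ht.2) h.lt₁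
    (fun t ht ↦ (h.cubic_nonneg_real ht).2) hs (show ω ∈ _ from ⟨hω, by linarith⟩) hs1
  have l1 := h.lt₁
  have l2 := h.lt₂
  rcases h.root_of_two_mul_mem (h.notMem_of_re (z := ω) (by simpa) (by simp; linarith)) h.mem_left
    with h2 | h2 | h2
  · exact h2
  all_goals rw [h2, Complex.ofReal_re] at h1; linarith

lemma weierstrassP_right (h : L.IsRectangular ω τ e₁ e₂ e₃) :
    L.weierstrassP (Complex.I * τ) = e₃ := by
  have hτ := h.pos_right
  obtain ⟨s, hs1, hs⟩ := ((L.tendsto_weierstrassP_I_mul_zero.eventually_le_atBot e₃).and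
    (Ioo_mem_nhdsGT (show 0 < 2 * τ by linarith))).exists
  have h1 : (L.weierstrassP (Complex.I * τ)).re ≤ e₃ := isPreconnected_Ioo.le_of_avoids_gap
    (continuousOn_re (f := fun t : ℝ ↦ Complex.I * t) (by fun_prop)
      fun t ht ↦ h.notMem_of_im (by simpa using ht.1) (by simpa using ht.2)) h.lt₂
    (fun t ht ↦ (h.cubic_nonpos_imag ht).2) hs (show τ ∈ _ from ⟨hτ, by linarith⟩) hs1
  have l1 := h.lt₁
  have l2 := h.lt₂
  rcases h.root_of_two_mul_mem (h.notMem_of_im (z := Complex.I * τ) (by simpa)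
    (by simp; linarith)) h.mem_right with h2 | h2 | h2
  · rw [h2, Complex.ofReal_re] at h1; linarith
  · rw [h2, Complex.ofReal_re] at h1; linarith
  · exact h2

lemma notMem_horizontal (h : L.IsRectangular ω τ e₁ e₂ e₃) (t : ℝ) :
    Complex.I * τ + t ∉ L.lattice := by
  have hτ := h.pos_right
  exact h.notMem_of_im (by simpa) (by simp; linarith)

lemma notMem_vertical (h : L.IsRectangular ω τ e₁ e₂ e₃) (t : ℝ) :
    ω + Complex.I * t ∉ L.lattice := by
  have hω := h.pos_left
  exact h.notMem_of_re (by simpa) (by simp; linarith)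

/-- The horizontal line from `iτ`, where `℘ = e₃`, cannot cross `(e₂, e₁)`; the vertical line from
`ω`, where `℘ = e₁`, cannot cross `(e₃, e₂)`. Both bounds meet at `e₂`. -/
lemma weierstrassP_left_add_right (h : L.IsRectangular ω τ e₁ e₂ e₃) :
    L.weierstrassP (ω + Complex.I * τ) = e₂ := by
  have l1 := h.lt₁
  have l2 := h.lt₂
  have h1 : (L.weierstrassP (Complex.I * τ + ω)).re ≤ e₂ :=
    isPreconnected_univ.le_of_avoids_gap
      (continuousOn_re (f := fun t : ℝ ↦ Complex.I * τ + t) (by fun_prop)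
        fun t _ ↦ h.notMem_horizontal t) h.lt₁
      (fun t _ ↦ (h.cubic_nonneg_horizontal t).2) (x := 0) trivial trivial
      (by simpa [h.weierstrassP_right] using l2.le)
  have h2 : e₂ ≤ (L.weierstrassP (ω + Complex.I * τ)).re :=
    isPreconnected_univ.ge_of_avoids_gap
      (continuousOn_re (f := fun t : ℝ ↦ ω + Complex.I * t) (by fun_prop)
        fun t _ ↦ h.notMem_vertical t) h.lt₂
      (fun t _ ↦ (h.cubic_nonpos_vertical t).2) (x := 0) trivial trivial
      (by simpa [h.weierstrassP_left] using l1.le)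
  rw [add_comm] at h1
  exact Complex.ext (by simpa using le_antisymm h1 h2) (by simpa using h.im_eq_zero_vertical τ)

/-- `℘` takes every real value below `e₃` on the open segment from `0` to `i τ`. -/
lemma exists_weierstrassP_eq_of_lt (h : L.IsRectangular ω τ e₁ e₂ e₃) {x : ℝ} (hx : x < e₃) :
    ∃ α : ℂ, α ∉ L.lattice ∧ |α.im| < τ ∧ L.weierstrassP α = x := by
  have hτ := h.pos_right
  have hnot : ∀ t ∈ Set.Ioc 0 τ, Complex.I * (t : ℝ) ∉ L.lattice := fun t ht ↦
    h.notMem_of_im (by simpa using ht.1) (by simpa using ht.2.trans_lt (by linarith))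
  obtain ⟨s, hs1, hs⟩ := ((L.tendsto_weierstrassP_I_mul_zero.eventually_le_atBot x).and
    (Ioc_mem_nhdsGT hτ)).exists
  obtain ⟨t, ht, htx⟩ := isPreconnected_Ioc.intermediate_value hs (Set.right_mem_Ioc.mpr hτ)
    (continuousOn_re (f := fun t : ℝ ↦ Complex.I * t) (by fun_prop) hnot)
    (show x ∈ Set.Icc _ _ from ⟨hs1, by simpa [h.weierstrassP_right] using hx.le⟩)
  refine ⟨Complex.I * t, hnot t ht, ?_, Complex.ext (by simpa using htx)
    (by simpa using h.im_eq_zero_imag t)⟩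
  have htτ : t ≠ τ := by
    rintro rfl
    simp only [h.weierstrassP_right, Complex.ofReal_re] at htx
    exact hx.ne' htx
  simpa [abs_of_pos ht.1] using lt_of_le_of_ne ht.2 htτ

/-- `℘` takes every real value between `e₂` and `e₁` on the segment from `ω` to `ω + i τ`. -/
lemma exists_weierstrassP_eq_of_mem_Ioo (h : L.IsRectangular ω τ e₁ e₂ e₃) {x : ℝ}
    (hx : x ∈ Set.Ioo e₂ e₁) :
    ∃ α : ℂ, α ∉ L.lattice ∧ |α.im| < τ ∧ L.weierstrassP α = x := by
  have hτ := h.pos_right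
  obtain ⟨t, ht, htx⟩ := (isPreconnected_Icc (a := 0) (b := τ)).intermediate_value
    (Set.right_mem_Icc.mpr hτ.le) (Set.left_mem_Icc.mpr hτ.le)
    (continuousOn_re (f := fun t : ℝ ↦ ω + Complex.I * t) (by fun_prop)
      fun t _ ↦ h.notMem_vertical t)
    (show x ∈ Set.Icc _ _ from ⟨by simpa [h.weierstrassP_left_add_right] using hx.1.le,
      by simpa [h.weierstrassP_left] using hx.2.le⟩)
  refine ⟨ω + Complex.I * t, h.notMem_vertical t, ?_, Complex.ext (by simpa using htx)
    (by simpa using h.im_eq_zero_vertical t)⟩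
  have htτ : t ≠ τ := by
    rintro rfl
    simp only [h.weierstrassP_left_add_right, Complex.ofReal_re] at htx
    exact hx.1.ne htx
  simpa [abs_of_nonneg ht.1] using lt_of_le_of_ne ht.2 htτ

end IsRectangular

end PeriodPair

/-! ### The metric as a Weierstrass function -/

section

open Filter MeasureTheory

lemma eq_of_hasDerivAt_weierstrass_ode_of_nonneg {f f' g g' : ℝ → ℝ} {k : ℝ}
    (hf : ∀ y, HasDerivAt f (f' y) y) (hf' : ∀ y, HasDerivAt f' (6 * f y ^ 2 - k) y)
    (hg : ∀ y, HasDerivAt g (g' y) y) (hg' : ∀ y, HasDerivAt g' (6 * g y ^ 2 - k) y)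
    (h₀ : f 0 = g 0) (h₀' : f' 0 = g' 0) {y : ℝ} (hy : 0 ≤ y) : f y = g y := by
  have cf : Continuous f := continuous_iff_continuousAt.mpr fun y ↦ (hf y).continuousAt
  have cg : Continuous g := continuous_iff_continuousAt.mpr fun y ↦ (hg y).continuousAt
  obtain ⟨C, hC⟩ := (isCompact_Icc (a := 0) (b := y)).exists_bound_of_continuousOn
    (f := fun t ↦ 6 * (f t + g t)) (by fun_prop)
  have hd : ∀ t, HasDerivAt (fun t ↦ (f t - g t, f' t - g' t))
      (f' t - g' t, 6 * (f t + g t) * (f t - g t)) t := by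
    intro t
    refine ((hf t).sub (hg t)).prodMk ?_
    convert! (hf' t).sub (hg' t) using 1
    ring
  have h0 : 0 ≤ C := (norm_nonneg _).trans (hC 0 ⟨le_rfl, hy⟩)
  -- Grönwall for the pair of differences: `6f² - 6g² = 6(f + g)(f - g)`, and `6(f + g)` is bounded
  -- by `C` on `[0, y]`. The constant `C + 1` dominates both components.
  have := eq_zero_of_abs_deriv_le_mul_abs_self_of_eq_zero_right (K := C + 1) (a := 0) (b := y)
    (f := fun t ↦ (f t - g t, f' t - g' t))
    (fun t _ ↦ (hd t).continuousAt.continuousWithinAt)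
    (fun t _ ↦ (hd t).hasDerivWithinAt) (by simp [h₀, h₀']) (by
      intro t ht
      have h1 := hC t ⟨ht.1, ht.2.le⟩
      rw [Prod.norm_def, Prod.norm_def]
      have m1 := le_max_left ‖f t - g t‖ ‖f' t - g' t‖
      have m2 := le_max_right ‖f t - g t‖ ‖f' t - g' t‖
      have m0 := (norm_nonneg _).trans m1
      refine max_le ?_ ?_
      · dsimp only
        nlinarith
      · dsimp only
        rw [norm_mul]
        calc _ ≤ C * max ‖f t - g t‖ ‖f' t - g' t‖ := by gcongr
          _ ≤ _ := by nlinarith) y ⟨hy, le_rfl⟩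
  have := congrArg Prod.fst this
  simpa [sub_eq_zero] using this

lemma eq_of_hasDerivAt_weierstrass_ode {f f' g g' : ℝ → ℝ} {k : ℝ}
    (hf : ∀ y, HasDerivAt f (f' y) y) (hf' : ∀ y, HasDerivAt f' (6 * f y ^ 2 - k) y)
    (hg : ∀ y, HasDerivAt g (g' y) y) (hg' : ∀ y, HasDerivAt g' (6 * g y ^ 2 - k) y)
    (h₀ : f 0 = g 0) (h₀' : f' 0 = g' 0) (y : ℝ) : f y = g y := by
  have hneg : ∀ {q q' : ℝ → ℝ}, (∀ y, HasDerivAt q (q' y) y) →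
      ∀ y, HasDerivAt (fun y ↦ q (-y)) (-q' (-y)) y := fun {q q'} h y ↦ by
    simpa using HasDerivAt.comp_const_sub 0 y (h (0 - y))
  have hneg' : ∀ {q q' : ℝ → ℝ}, (∀ y, HasDerivAt q (q' y) y) →
      ∀ y, HasDerivAt (fun y ↦ -q (-y)) (q' (-y)) y := fun {q q'} h y ↦ by
    simpa using (hneg h y).fun_neg
  rcases le_total 0 y with hy | hy
  · exact eq_of_hasDerivAt_weierstrass_ode_of_nonneg hf hf' hg hg' h₀ h₀' hy
  · simpa using eq_of_hasDerivAt_weierstrass_ode_of_nonneg (hneg hf) (hneg' hf') (hneg hg)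
      (hneg' hg') (by simpa) (by simpa) (neg_nonneg.mpr hy)

namespace IsEquivariantMetric

variable {u : ℝ → ℝ} {ψ : ℂ} {β : ℝ}

/-- The function `β/3 - 2 e^u`, a solution of the differential equation of `℘`. -/
noncomputable def profile (u : ℝ → ℝ) (β : ℝ) (y : ℝ) : ℝ := β / 3 - 2 * Real.exp (u y)

lemma hasDerivAt (h : IsEquivariantMetric u ψ β) (y : ℝ) : HasDerivAt u (deriv u y) y :=
  (h.contDiff.differentiable (by norm_num)).differentiableAt.hasDerivAt

lemma hasDerivAt_deriv (h : IsEquivariantMetric u ψ β) (y : ℝ) :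
    HasDerivAt (deriv u) (deriv (deriv u) y) y := by
  have h1 : ContDiff ℝ (1 + 1) u := by
    have := h.contDiff
    norm_num
    exact this
  exact ((contDiff_succ_iff_deriv.mp h1).2.2.differentiable (by norm_num)).differentiableAt.hasDerivAt

lemma norm_sq_pos (h : IsEquivariantMetric u ψ β) : 0 < ‖ψ‖ ^ 2 := by
  have := norm_pos_iff.mpr h.hopf_ne_zero
  positivity

lemma exp_neg_two_mul (x : ℝ) : Real.exp (-2 * x) = (Real.exp x ^ 2)⁻¹ := by
  rw [← Real.exp_nat_mul, ← Real.exp_neg]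
  norm_num

lemma exp_mul_deriv_sq (h : IsEquivariantMetric u ψ β) (y : ℝ) :
    (Real.exp (u y) * deriv u y) ^ 2 =
      4 * β * Real.exp (u y) ^ 2 - 8 * Real.exp (u y) ^ 3 - 4 * ‖ψ‖ ^ 2 := by
  have h1 := h.first_integral y
  rw [exp_neg_two_mul] at h1
  have h2 := Real.exp_pos (u y)
  field_simp at h1
  linear_combination h1

lemma hasDerivAt_profile (h : IsEquivariantMetric u ψ β) (y : ℝ) :
    HasDerivAt (profile u β) (-2 * (Real.exp (u y) * deriv u y)) y := by
  convert! ((h.hasDerivAt y).exp.const_mul 2).const_sub (β / 3) using 1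
  ring

lemma hasDerivAt_deriv_profile (h : IsEquivariantMetric u ψ β) (y : ℝ) :
    HasDerivAt (fun y ↦ -2 * (Real.exp (u y) * deriv u y))
      (6 * profile u β y ^ 2 - 2 / 3 * β ^ 2) y := by
  convert! ((h.hasDerivAt y).exp.mul (h.hasDerivAt_deriv y)).const_mul (-2) using 1
  have h1 := h.first_integral y
  have h3 := h.gauss y
  rw [exp_neg_two_mul] at h1 h3
  have h2 := Real.exp_pos (u y)
  simp only [profile]
  field_simp at h1 h3
  have h4 : Real.exp (u y) ^ 2 * deriv (deriv u) y = 4 * ‖ψ‖ ^ 2 - 4 * Real.exp (u y) ^ 3 := by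
    linear_combination h3
  refine mul_right_cancel₀ h2.ne' ?_
  linear_combination 2 * h1 + 2 * h4

lemma deriv_profile_sq (h : IsEquivariantMetric u ψ β) (y : ℝ) :
    (-2 * (Real.exp (u y) * deriv u y)) ^ 2 = 4 * profile u β y ^ 3 -
      4 / 3 * β ^ 2 * profile u β y - (16 * ‖ψ‖ ^ 2 - 8 / 27 * β ^ 3) := by
  rw [mul_pow, h.exp_mul_deriv_sq, profile]
  ring

lemma root_zero (h : IsEquivariantMetric u ψ β) :
    8 * Real.exp (u 0) ^ 3 - 4 * β * Real.exp (u 0) ^ 2 + 4 * ‖ψ‖ ^ 2 = 0 :=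
  h.largest_root.1

lemma beta_pos (h : IsEquivariantMetric u ψ β) : 0 < β := by
  have h1 := h.root_zero
  have h2 := Real.exp_pos (u 0)
  have h3 := h.norm_sq_pos
  by_contra! hb
  have : 0 < Real.exp (u 0) ^ 3 := by positivity
  have : 0 ≤ -β * Real.exp (u 0) ^ 2 := mul_nonneg (by linarith) (by positivity)
  linarith

lemma le_beta_cube (h : IsEquivariantMetric u ψ β) : 27 * ‖ψ‖ ^ 2 ≤ β ^ 3 := by
  have h1 := h.root_zero
  have h2 := Real.exp_pos (u 0)
  -- By the root equation this product equals `β³ - 27‖ψ‖²`.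
  have h3 : 0 ≤ (β - 3 * Real.exp (u 0)) ^ 2 * (β + 6 * Real.exp (u 0)) := by
    have := h.beta_pos
    positivity
  linarith

/-- Equality would make `p(0) = -β/3` an equilibrium of `p'' = 6p² - g₂/2`, and uniqueness would
force `u` to be constant. This is what separates the two largest roots. -/
lemma exp_zero_ne (h : IsEquivariantMetric u ψ β) : 3 * Real.exp (u 0) ≠ β := by
  intro h0
  refine h.not_constant ⟨u 0, fun y ↦ ?_⟩
  have hconst : ∀ x : ℝ, HasDerivAt (fun _ : ℝ ↦ (0 : ℝ)) (6 * (-β / 3) ^ 2 - 2 / 3 * β ^ 2) x := by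
    intro x
    convert! hasDerivAt_const x (0 : ℝ) using 1
    ring
  have hp0 : profile u β 0 = -β / 3 := by rw [profile]; linear_combination (-2 / 3) * h0
  have key : profile u β y = -β / 3 :=
    eq_of_hasDerivAt_weierstrass_ode (g := fun _ ↦ -β / 3) (g' := fun _ ↦ 0)
      h.hasDerivAt_profile h.hasDerivAt_deriv_profile
      (fun x ↦ hasDerivAt_const x _) hconst hp0 (by simp [h.deriv_zero]) y
  rw [profile] at key
  exact Real.exp_injective (by linear_combination (-1 / 2) * key - h0 / 3)

/-- The two other roots of the cubic of which `e^{u(0)}` is the largest root. -/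
lemma exists_roots (h : IsEquivariantMetric u ψ β) :
    ∃ v₂ v₃ : ℝ, v₃ < v₂ ∧ v₂ < Real.exp (u 0) ∧ ∀ w : ℂ,
      8 * w ^ 3 - 4 * β * w ^ 2 + 4 * (‖ψ‖ : ℂ) ^ 2 = 8 * (w - Real.exp (u 0)) * (w - v₂) * (w - v₃) := by
  have h1 := h.root_zero
  have h2 := Real.exp_pos (u 0)
  have h3 := h.norm_sq_pos
  set v := Real.exp (u 0) with hv
  have h4 : 0 < β - 2 * v := by
    have : 0 < v ^ 2 * (β - 2 * v) := by linarith
    exact pos_of_mul_pos_right this (by positivity)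
  -- Division by `w - v` leaves `8w² - 4(β - 2v)w - 4v(β - 2v)`, with roots `(β - 2v ± r)/4`.
  set r := √((β - 2 * v) ^ 2 + 8 * v * (β - 2 * v)) with hr
  have hpos : 0 < (β - 2 * v) ^ 2 + 8 * v * (β - 2 * v) := by positivity
  have hr0 : 0 < r := Real.sqrt_pos.mpr hpos
  have hr2 : r ^ 2 = (β - 2 * v) ^ 2 + 8 * v * (β - 2 * v) := Real.sq_sqrt hpos.le
  have hfac : ∀ w : ℂ, 8 * w ^ 3 - 4 * β * w ^ 2 + 4 * (‖ψ‖ : ℂ) ^ 2 =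
      8 * (w - v) * (w - ((β - 2 * v + r) / 4 : ℝ)) * (w - ((β - 2 * v - r) / 4 : ℝ)) := by
    intro w
    have h1' : 8 * (v : ℂ) ^ 3 - 4 * β * v ^ 2 + 4 * (‖ψ‖ : ℂ) ^ 2 = 0 := by exact_mod_cast h1
    have hr2' : (r : ℂ) ^ 2 = (β - 2 * v) ^ 2 + 8 * v * (β - 2 * v) := by exact_mod_cast hr2
    push_cast
    linear_combination h1' + (w - v) / 2 * hr2'
  refine ⟨(β - 2 * v + r) / 4, (β - 2 * v - r) / 4, by linarith, lt_of_le_of_ne ?_ ?_, hfac⟩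
  · refine h.largest_root.2 ?_
    have := hfac ((β - 2 * v + r) / 4 : ℝ)
    rw [sub_self, mul_zero, zero_mul] at this
    exact_mod_cast this
  · intro h5
    refine h.exp_zero_ne ?_
    have h6 : r = 6 * v - β := by linarith
    rw [h6] at hr2
    have h7 : v * (3 * v - β) = 0 := by linear_combination hr2 / 16
    rcases mul_eq_zero.mp h7 with h8 | h8
    · exact absurd h8 h2.ne'
    · linarith

/-- The substitution `x = β/3 - 2w` reverses the order of the roots, so the largest root `e^{u(0)}`
becomes the smallest root `e₃ = p(0)`. -/
lemma exists_isRectangular (h : IsEquivariantMetric u ψ β) {ω τ : ℝ} (hω : 0 < ω) (hτ : 0 < τ)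
    {L : PeriodPair} (hL₁ : L.ω₁ = 2 * ω) (hL₂ : L.ω₂ = 2 * (Complex.I * τ))
    (hLg₂ : L.g₂ = (4 / 3 * β ^ 2 : ℝ)) (hLg₃ : L.g₃ = (16 * ‖ψ‖ ^ 2 - 8 / 27 * β ^ 3 : ℝ)) :
    ∃ e₁ e₂ : ℝ, L.IsRectangular ω τ e₁ e₂ (profile u β 0) := by
  obtain ⟨v₂, v₃, h1, h2, h3⟩ := h.exists_roots
  refine ⟨β / 3 - 2 * v₃, β / 3 - 2 * v₂, hω, hτ, hL₁, hL₂, fun x ↦ ?_, by linarith, by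
    rw [profile]; linarith⟩
  rw [hLg₂, hLg₃, profile]
  have := h3 ((β / 3 - x) / 2)
  push_cast at this ⊢
  linear_combination -4 * this

lemma weierstrassP_eq_profile (h : IsEquivariantMetric u ψ β) {ω τ : ℝ} {L : PeriodPair}
    {e₁ e₂ : ℝ} (hR : L.IsRectangular ω τ e₁ e₂ (profile u β 0))
    (hLg₂ : L.g₂ = (4 / 3 * β ^ 2 : ℝ)) (y : ℝ) :
    L.weierstrassP (Complex.I * τ + y) = profile u β y := by
  have d1 : ∀ t : ℝ, HasDerivAt (fun t : ℝ ↦ L.weierstrassP (Complex.I * τ + t))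
      (L.derivWeierstrassP (Complex.I * τ + t)) t := fun t ↦
    ((L.hasDerivAt_weierstrassP (hR.notMem_horizontal t)).comp_const_add _ _).comp_ofReal
  have d2 : ∀ t : ℝ, HasDerivAt (fun t : ℝ ↦ L.derivWeierstrassP (Complex.I * τ + t))
      (6 * L.weierstrassP (Complex.I * τ + t) ^ 2 - L.g₂ / 2) t := fun t ↦
    ((L.hasDerivAt_derivWeierstrassP (hR.notMem_horizontal t)).comp_const_add _ _).comp_ofReal
  have hre : ∀ t : ℝ, L.weierstrassP (Complex.I * τ + t) =
      (L.weierstrassP (Complex.I * τ + t)).re := fun t ↦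
    Complex.ext rfl (by simpa using hR.im_eq_zero_horizontal t)
  have e1 : ∀ t : ℝ, HasDerivAt (fun t : ℝ ↦ (L.weierstrassP (Complex.I * τ + t)).re)
      (L.derivWeierstrassP (Complex.I * τ + t)).re t := fun t ↦
    Complex.reCLM.hasFDerivAt.comp_hasDerivAt t (d1 t)
  have e2 : ∀ t : ℝ, HasDerivAt (fun t : ℝ ↦ (L.derivWeierstrassP (Complex.I * τ + t)).re)
      (6 * (L.weierstrassP (Complex.I * τ + t)).re ^ 2 - 2 / 3 * β ^ 2) t := fun t ↦ by
    have := Complex.reCLM.hasFDerivAt.comp_hasDerivAt t (d2 t)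
    convert! this using 1
    rw [hre t, hLg₂]
    simp only [Complex.reCLM_apply]
    norm_cast
    ring
  have h0 : L.derivWeierstrassP (Complex.I * τ) = 0 :=
    L.derivWeierstrassP_eq_zero_of_two_mul_mem hR.mem_right
  rw [hre y]
  exact_mod_cast eq_of_hasDerivAt_weierstrass_ode e1 e2 h.hasDerivAt_profile
    h.hasDerivAt_deriv_profile (by simp [hR.weierstrassP_right]) (by simp [h0, h.deriv_zero]) y

end IsEquivariantMetric

/-! ### The shifted cubic, partial fractions and the characteristic polynomial -/

lemma exists_isRoot_of_neg_of_pos {a b : ℝ} {f : ℝ → ℝ} (hf : Continuous f) (hab : a < b)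
    (h : f a * f b < 0) : ∃ x ∈ Set.Ioo a b, f x = 0 := by
  rcases mul_neg_iff.mp h with ⟨h1, h2⟩ | ⟨h1, h2⟩
  · exact intermediate_value_Ioo' hab.le hf.continuousOn ⟨h2, h1⟩
  · exact intermediate_value_Ioo hab.le hf.continuousOn ⟨h1, h2⟩

/-- Three distinct real roots of `D³ + β D² - 4 R²`. -/
lemma exists_cubic_roots {β R : ℝ} (hβ : 0 < β) (hR : R ≠ 0) (h : 27 * R ^ 2 < β ^ 3) :
    ∃ D : Fin 3 → ℝ, StrictAnti D ∧ (∀ j, D j ≠ 0) ∧ D 0 + D 1 + D 2 = -β ∧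
      D 0 * D 1 + D 0 * D 2 + D 1 * D 2 = 0 ∧ D 0 * D 1 * D 2 = 4 * R ^ 2 := by
  have hR2 : 0 < R ^ 2 := by positivity
  set f : ℝ → ℝ := fun x ↦ x ^ 3 + β * x ^ 2 - 4 * R ^ 2 with hf
  have hc : Continuous f := by fun_prop
  have f0 : f 0 < 0 := by simp [hf, hR2]
  have f1 : f (-β) < 0 := by
    have : f (-β) = -4 * R ^ 2 := by simp only [hf]; ring
    linarith
  -- The point `-2β/3` is the local maximum of `f`; the hypothesis `27R² < β³` says exactly that `f`
  -- is positive there.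
  have f2 : 0 < f (-(2 * β / 3)) := by
    have : f (-(2 * β / 3)) = 4 / 27 * β ^ 3 - 4 * R ^ 2 := by simp only [hf]; ring
    linarith
  have f3 : 0 < f (4 * R ^ 2 + 1) := by
    have : f (4 * R ^ 2 + 1) = 1 + 8 * R ^ 2 + 48 * (R ^ 2) ^ 2 + 64 * (R ^ 2) ^ 3 +
      β * (4 * R ^ 2 + 1) ^ 2 := by simp only [hf]; ring
    rw [this]
    positivity
  obtain ⟨a, ha, ha0⟩ := exists_isRoot_of_neg_of_pos hc (by linarith : 0 < 4 * R ^ 2 + 1)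
    (mul_neg_of_neg_of_pos f0 f3)
  obtain ⟨b, hb, hb0⟩ := exists_isRoot_of_neg_of_pos hc (by linarith : -(2 * β / 3) < 0)
    (mul_neg_of_pos_of_neg f2 f0)
  obtain ⟨c, hc', hc0⟩ := exists_isRoot_of_neg_of_pos hc (by linarith : -β < -(2 * β / 3))
    (mul_neg_of_neg_of_pos f1 f2)
  have hab : b < a := hb.2.trans ha.1
  have hbc : c < b := hc'.2.trans hb.1
  simp only [hf] at ha0 hb0 hc0
  -- Vieta's relations follow from divided differences of `f` at the distinct roots.
  have q1 : a ^ 2 + a * b + b ^ 2 + β * (a + b) = 0 := by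
    refine mul_left_cancel₀ (sub_ne_zero.mpr hab.ne') ?_
    linear_combination ha0 - hb0
  have q2 : a ^ 2 + a * c + c ^ 2 + β * (a + c) = 0 := by
    refine mul_left_cancel₀ (sub_ne_zero.mpr (hbc.trans hab).ne') ?_
    linear_combination ha0 - hc0
  have s1 : a + b + c = -β := by
    refine mul_left_cancel₀ (sub_ne_zero.mpr hbc.ne') ?_
    linear_combination q1 - q2
  have s2 : a * b + a * c + b * c = 0 := by
    linear_combination -q1 + (a + b) * s1
  have s3 : a * b * c = 4 * R ^ 2 := by
    linear_combination ha0 - a ^ 2 * s1 + a * s2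
  refine ⟨![a, b, c], ?_, ?_, by simpa using s1, by simpa using s2, by simpa using s3⟩
  · refine Fin.strictAnti_iff_succ_lt.mpr fun i ↦ ?_
    fin_cases i
    · exact hab
    · exact hbc
  · intro j
    fin_cases j
    · exact ha.1.ne'
    · exact hb.2.ne
    · exact (hbc.trans hb.2).ne

lemma Fin.prod_three_sub {R : Type*} [CommRing R] (f : Fin 3 → R) (x : R) :
    ∏ j, (x - f j) = x ^ 3 - (f 0 + f 1 + f 2) * x ^ 2 +
      (f 0 * f 1 + f 0 * f 2 + f 1 * f 2) * x - f 0 * f 1 * f 2 := by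
  rw [Fin.prod_univ_three]
  ring

/-- Partial fractions for three simple poles. -/
lemma partial_fractions {e : Fin 3 → ℝ} (he : Function.Injective e) {x : ℝ} (hx : ∀ j, x ≠ e j)
    (m n : ℝ) :
    (m + n * x) / ∏ j, (x - e j) = ∑ j, (m + n * e j) / rootProduct e j * (x - e j)⁻¹ := by
  have h01 : e 0 - e 1 ≠ 0 := sub_ne_zero.mpr (he.ne (by decide))
  have h02 : e 0 - e 2 ≠ 0 := sub_ne_zero.mpr (he.ne (by decide))
  have h12 : e 1 - e 2 ≠ 0 := sub_ne_zero.mpr (he.ne (by decide))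
  have h0 := sub_ne_zero.mpr (hx 0)
  have h1 := sub_ne_zero.mpr (hx 1)
  have h2 := sub_ne_zero.mpr (hx 2)
  have r0 : rootProduct e 0 = (e 0 - e 1) * (e 0 - e 2) := rfl
  have r1 : rootProduct e 1 = -((e 0 - e 1) * (e 1 - e 2)) := by
    rw [show rootProduct e 1 = (e 1 - e 2) * (e 1 - e 0) from rfl]; ring
  have r2 : rootProduct e 2 = (e 0 - e 2) * (e 1 - e 2) := by
    rw [show rootProduct e 2 = (e 2 - e 0) * (e 2 - e 1) from rfl]; ring
  rw [Fin.prod_univ_three, Fin.sum_univ_three, r0, r1, r2]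
  field_simp
  ring

lemma conj_eq_inv_of_norm_eq_one {z : ℂ} (h : ‖z‖ = 1) : (starRingEnd ℂ) z = z⁻¹ := by
  rw [Complex.inv_def, Complex.normSq_eq_norm_sq, h]
  simp

section Hopf

variable {ψ lam : ℂ}

lemma conj_hopfCoeff (hlam : ‖lam‖ = 1) :
    (starRingEnd ℂ) (hopfCoeff ψ lam) = lam ^ 3 * (starRingEnd ℂ) ψ := by
  rw [hopfCoeff, map_mul, map_inv₀, map_pow, conj_eq_inv_of_norm_eq_one hlam, inv_pow, inv_inv]

lemma hopfCoeff_re_sq_add_im_sq (hlam : ‖lam‖ = 1) :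
    (hopfCoeff ψ lam).re ^ 2 + (hopfCoeff ψ lam).im ^ 2 = ‖ψ‖ ^ 2 := by
  have : ‖hopfCoeff ψ lam‖ = ‖ψ‖ := by simp [hopfCoeff, hlam]
  rw [← this, ← Complex.normSq_eq_norm_sq, Complex.normSq_apply]
  ring

lemma betaDenom_eq (hlam : ‖lam‖ = 1) (u : ℝ → ℝ) (s : ℝ) :
    betaDenom u ψ lam s =
      -2 * Complex.I * (hopfCoeff ψ lam).im - (Real.exp (u s) * deriv u s : ℝ) := by
  rw [betaDenom, ← conj_hopfCoeff hlam]
  congr 1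
  apply Complex.ext <;> simp
  ring

/-- For `|λ| = 1` the numerator is `i` times the denominator plus `2i Re(λ⁻³ψ)`. -/
lemma betaOneIntegrand_eq (hlam : ‖lam‖ = 1) (u : ℝ → ℝ) {s : ℝ} (h : betaDenom u ψ lam s ≠ 0) :
    betaOneIntegrand u ψ lam s =
      Complex.I + 2 * Complex.I * (hopfCoeff ψ lam).re / betaDenom u ψ lam s := by
  have h1 : lam ^ 3 * (starRingEnd ℂ) ψ = (hopfCoeff ψ lam).re -
      Complex.I * (hopfCoeff ψ lam).im := by
    rw [← conj_hopfCoeff hlam]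
    apply Complex.ext <;> simp
  rw [betaOneIntegrand, div_eq_iff h, add_mul, div_mul_cancel₀ _ h, betaDenom_eq hlam,
    mul_assoc (2 * Complex.I), h1]
  push_cast
  ring

end Hopf

namespace IsEquivariantMetric

variable {u : ℝ → ℝ} {ψ lam : ℂ} {β : ℝ}

lemma charpoly_potentialMatrix (h : IsEquivariantMetric u ψ β) (hlam : ‖lam‖ = 1) :
    (potentialMatrix u ψ lam).charpoly = Polynomial.X ^ 3 + Polynomial.C (β : ℂ) * Polynomial.X -
      Polynomial.C (2 * Complex.I * (hopfCoeff ψ lam).re) := by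
  refine Polynomial.funext fun x ↦ ?_
  have hl : lam ≠ 0 := norm_pos_iff.mp (by rw [hlam]; exact one_pos)
  have hn : ψ * (starRingEnd ℂ) ψ = (‖ψ‖ : ℂ) ^ 2 := Complex.mul_conj' ψ
  have hre : (2 * (hopfCoeff ψ lam).re : ℂ) =
      (lam ^ 3)⁻¹ * ψ + lam ^ 3 * (starRingEnd ℂ) ψ := by
    have := Complex.add_conj (hopfCoeff ψ lam)
    rw [conj_hopfCoeff hlam] at this
    rw [← hopfCoeff, this]
    push_cast
    ring
  have he : (Real.exp (-u 0) : ℂ) = (Real.exp (u 0) : ℂ)⁻¹ := by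
    rw [Real.exp_neg]; push_cast; rfl
  have he2 : (Real.exp (u 0 / 2) : ℂ) ^ 2 = Real.exp (u 0) := by
    rw [← Complex.ofReal_pow, ← Real.exp_nat_mul]
    congr 2
    ring
  have hv : (Real.exp (u 0) : ℂ) ≠ 0 := by exact_mod_cast (Real.exp_pos (u 0)).ne'
  have hroot : 8 * (Real.exp (u 0) : ℂ) ^ 3 - 4 * β * (Real.exp (u 0) : ℂ) ^ 2 +
      4 * (‖ψ‖ : ℂ) ^ 2 = 0 := by exact_mod_cast h.root_zero
  -- This is the first integral at `0`; the right-hand side is the coefficient of `x` in the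
  -- determinant.
  have hβ : (β : ℂ) = 2 * Real.exp (u 0) + ψ * (starRingEnd ℂ) ψ / (Real.exp (u 0) : ℂ) ^ 2 := by
    rw [hn]
    field_simp
    linear_combination -hroot / 4
  rw [Matrix.eval_charpoly, Matrix.det_fin_three]
  simp only [potentialMatrix, Matrix.sub_apply, Matrix.scalar_apply, Matrix.diagonal_apply,
    Matrix.of_apply, Matrix.cons_val', Matrix.cons_val, Fin.isValue, Polynomial.eval_add,
    Polynomial.eval_sub, Polynomial.eval_mul, Polynomial.eval_pow, Polynomial.eval_X,
    Polynomial.eval_C]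
  simp only [Fin.reduceEq, if_true, if_false]
  rw [show 2 * Complex.I * ((hopfCoeff ψ lam).re : ℂ) =
    Complex.I * (2 * (hopfCoeff ψ lam).re) by ring, hre, he, hβ]
  have ha : (Real.exp (u 0 / 2) : ℂ) ≠ 0 := by exact_mod_cast (Real.exp_pos _).ne'
  rw [← he2]
  generalize (Real.exp (u 0 / 2) : ℂ) = a at ha
  field_simp
  ring_nf
  simp only [Complex.I_sq, show Complex.I ^ 3 = -Complex.I from Complex.I_pow_three]
  ring

end IsEquivariantMetric

/-! ### Reflection of the period and the integrals for nonreal `λ⁻³ψ` -/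

lemma intervalIntegral_eq_zero_of_reflect_neg {f : ℝ → ℝ} {b : ℝ} (h : ∀ s, f (b - s) = -f s) :
    ∫ s in (0 : ℝ)..b, f s = 0 := by
  have h1 := intervalIntegral.integral_comp_sub_left f (a := 0) (b := b) b
  simp only [h, intervalIntegral.integral_neg, sub_self, sub_zero] at h1
  linarith

lemma inv_neg_two_I_mul_sub (w : ℝ) {k : ℝ} (hk : k ≠ 0) :
    (-2 * Complex.I * k - (w : ℂ))⁻¹ =
      (-w / (w ^ 2 + 4 * k ^ 2) : ℝ) + 2 * Complex.I * k * (1 / (w ^ 2 + 4 * k ^ 2) : ℝ) := by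
  have hq : ((w : ℂ) ^ 2 + 4 * (k : ℂ) ^ 2) ≠ 0 := by
    have : w ^ 2 + 4 * k ^ 2 ≠ 0 := by positivity
    exact_mod_cast this
  refine inv_eq_of_mul_eq_one_right ?_
  push_cast
  trans (-2 * Complex.I * k - w) * (-w + 2 * Complex.I * k) / ((w : ℂ) ^ 2 + 4 * (k : ℂ) ^ 2)
  · ring
  · rw [div_eq_one_iff_eq hq]
    linear_combination (-4 * (k : ℂ) ^ 2) * Complex.I_sq

namespace IsEquivariantMetric

variable {u : ℝ → ℝ} {ψ lam : ℂ} {β : ℝ}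

section Period

variable {ω τ e₁ e₂ : ℝ} {L : PeriodPair}

lemma profile_reflect (h : IsEquivariantMetric u ψ β)
    (hR : L.IsRectangular ω τ e₁ e₂ (profile u β 0)) (hLg₂ : L.g₂ = (4 / 3 * β ^ 2 : ℝ)) (s : ℝ) :
    profile u β (2 * ω - s) = profile u β s := by
  have h1 := h.weierstrassP_eq_profile hR hLg₂ (2 * ω - s)
  have h2 := h.weierstrassP_eq_profile hR hLg₂ s
  have h3 := L.weierstrassP_add_coe (-(Complex.I * τ + s))
    ⟨_, add_mem hR.mem_left hR.mem_right⟩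
  -- The point `iτ + 2ω - s` is `-(iτ + s)` plus the period `2ω + 2iτ`.
  rw [L.weierstrassP_neg, h2, show -(Complex.I * τ + s) + (2 * ω + 2 * (Complex.I * τ)) =
    Complex.I * τ + ((2 * ω - s : ℝ) : ℂ) by push_cast; ring, h1] at h3
  exact_mod_cast h3

lemma exp_reflect (h : IsEquivariantMetric u ψ β)
    (hR : L.IsRectangular ω τ e₁ e₂ (profile u β 0)) (hLg₂ : L.g₂ = (4 / 3 * β ^ 2 : ℝ)) (s : ℝ) :
    Real.exp (u (2 * ω - s)) = Real.exp (u s) := by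
  have := h.profile_reflect hR hLg₂ s
  simp only [profile] at this
  linarith

lemma exp_mul_deriv_reflect (h : IsEquivariantMetric u ψ β)
    (hR : L.IsRectangular ω τ e₁ e₂ (profile u β 0)) (hLg₂ : L.g₂ = (4 / 3 * β ^ 2 : ℝ)) (s : ℝ) :
    Real.exp (u (2 * ω - s)) * deriv u (2 * ω - s) = -(Real.exp (u s) * deriv u s) := by
  have h1 := HasDerivAt.comp_const_sub (2 * ω) s (h.hasDerivAt_profile (2 * ω - s))
  simp only [h.profile_reflect hR hLg₂] at h1
  have := h1.unique (h.hasDerivAt_profile s)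
  linarith

end Period

lemma continuous_exp (h : IsEquivariantMetric u ψ β) : Continuous fun s ↦ Real.exp (u s) :=
  Real.continuous_exp.comp h.contDiff.continuous

lemma continuous_deriv (h : IsEquivariantMetric u ψ β) : Continuous (deriv u) :=
  continuous_iff_continuousAt.mpr fun y ↦ (h.hasDerivAt_deriv y).continuousAt

lemma continuous_profile (h : IsEquivariantMetric u ψ β) : Continuous (profile u β) := by
  have := h.continuous_exp
  unfold profile
  fun_prop

lemma continuous_betaDenom (h : IsEquivariantMetric u ψ β) : Continuous (betaDenom u ψ lam) := by
  have h1 := h.continuous_exp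
  have h2 := h.continuous_deriv
  unfold betaDenom
  fun_prop

lemma continuous_betaOneIntegrand_num (h : IsEquivariantMetric u ψ β) :
    Continuous fun s ↦ (2 * Complex.I * lam ^ 3 * (starRingEnd ℂ) ψ
      - Complex.I * (deriv u s * Real.exp (u s) : ℝ)) := by
  have h1 := h.continuous_exp
  have h2 := h.continuous_deriv
  fun_prop

lemma continuous_betaTwoIntegrand_num (h : IsEquivariantMetric u ψ β) :
    Continuous fun s ↦ ((2 * Real.exp (u s) : ℝ) : ℂ) := by
  have h1 := h.continuous_exp
  fun_prop

lemma betaDenom_ne_zero (hlam : ‖lam‖ = 1) (hI : (hopfCoeff ψ lam).im ≠ 0) (s : ℝ) :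
    betaDenom u ψ lam s ≠ 0 := by
  intro h
  have h1 := congrArg Complex.im h
  rw [betaDenom_eq hlam] at h1
  simp [hI] at h1

lemma inv_betaDenom (hlam : ‖lam‖ = 1) (hI : (hopfCoeff ψ lam).im ≠ 0) (s : ℝ) :
    (betaDenom u ψ lam s)⁻¹ =
      (-(Real.exp (u s) * deriv u s) /
        ((Real.exp (u s) * deriv u s) ^ 2 + 4 * (hopfCoeff ψ lam).im ^ 2) : ℝ) +
      2 * Complex.I * (hopfCoeff ψ lam).im *
        (1 / ((Real.exp (u s) * deriv u s) ^ 2 + 4 * (hopfCoeff ψ lam).im ^ 2) : ℝ) := by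
  rw [betaDenom_eq hlam]
  exact inv_neg_two_I_mul_sub _ hI

/-- The factorization of `(e^u u')² + 4 Im(λ⁻³ψ)²` over the shifted roots. -/
lemma prod_profile_sub (h : IsEquivariantMetric u ψ β) (hlam : ‖lam‖ = 1) {D : Fin 3 → ℝ}
    (s1 : D 0 + D 1 + D 2 = -β) (s2 : D 0 * D 1 + D 0 * D 2 + D 1 * D 2 = 0)
    (s3 : D 0 * D 1 * D 2 = 4 * (hopfCoeff ψ lam).re ^ 2) (s : ℝ) :
    ∏ j, (profile u β s - (β / 3 + D j)) =
      (Real.exp (u s) * deriv u s) ^ 2 + 4 * (hopfCoeff ψ lam).im ^ 2 := by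
  have h1 := h.deriv_profile_sq s
  have h2 := hopfCoeff_re_sq_add_im_sq (ψ := ψ) hlam
  simp only [← sub_sub]
  rw [Fin.prod_three_sub, s1, s2, s3]
  linear_combination h1 / (-4) - 4 * h2

lemma phaseIntegrand_eq {D : ℝ} (hD : D ≠ 0)
    (hR : (hopfCoeff ψ lam).re ≠ 0) {s : ℝ} (hs : profile u β s ≠ β / 3 + D) :
    phaseIntegrand u ψ lam (-2 * (hopfCoeff ψ lam).re / D) s =
      -2 * (hopfCoeff ψ lam).im * (profile u β s - (β / 3 + D))⁻¹ := by
  have h1 := sub_ne_zero.mpr hs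
  have h2 : -2 * (hopfCoeff ψ lam).re / D * Real.exp (u s) - (hopfCoeff ψ lam).re =
      (hopfCoeff ψ lam).re / D * (profile u β s - (β / 3 + D)) := by
    rw [profile]
    field_simp
    ring
  rw [phaseIntegrand, h2]
  field_simp

section Integrals

variable {ω τ e₁ e₂ : ℝ} {L : PeriodPair}

lemma profile_ne {e : Fin 3 → ℝ}
    (hI : (hopfCoeff ψ lam).im ≠ 0)
    (hprod : ∀ s, ∏ j, (profile u β s - e j) =
      (Real.exp (u s) * deriv u s) ^ 2 + 4 * (hopfCoeff ψ lam).im ^ 2) (j : Fin 3) (s : ℝ) :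
    profile u β s ≠ e j := by
  intro h0
  have h1 := hprod s
  rw [Finset.prod_eq_zero (Finset.mem_univ j) (sub_eq_zero.mpr h0)] at h1
  have : 0 < (Real.exp (u s) * deriv u s) ^ 2 + 4 * (hopfCoeff ψ lam).im ^ 2 := by positivity
  linarith

lemma integral_inv_profile_sub (h : IsEquivariantMetric u ψ β)
    (hR : L.IsRectangular ω τ e₁ e₂ (profile u β 0)) (hLg₂ : L.g₂ = (4 / 3 * β ^ 2 : ℝ))
    {α : ℂ} {x : ℝ} (hα : |α.im| < τ) (hα' : L.derivWeierstrassP α ≠ 0)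
    (hx : L.weierstrassP α = x) :
    ((∫ s in (0 : ℝ)..(2 * ω), (profile u β s - x)⁻¹ : ℝ) : ℂ) = zetaTerm L ω α := by
  rw [← PeriodPair.integral_inv_weierstrassP_sub hR.pos_right hR.left hR.right hα hα',
    ← intervalIntegral.integral_ofReal]
  refine intervalIntegral.integral_congr fun s _ ↦ ?_
  rw [h.weierstrassP_eq_profile hR hLg₂ s, hx]
  push_cast
  rfl

/-- The integral of a quotient of a linear polynomial in `β/3 - 2 e^u` by the product over the
shifted roots. -/
lemma integral_linear_div (h : IsEquivariantMetric u ψ β) {e : Fin 3 → ℝ}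
    (he : Function.Injective e) (hne : ∀ j s, profile u β s ≠ e j) (m n b : ℝ) :
    ∫ s in (0 : ℝ)..b, (m + n * profile u β s) / ∏ j, (profile u β s - e j) =
      ∑ j, (m + n * e j) / rootProduct e j * ∫ s in (0 : ℝ)..b, (profile u β s - e j)⁻¹ := by
  simp_rw [fun s ↦ partial_fractions he (fun j ↦ hne j s) m n]
  rw [intervalIntegral.integral_finsetSum]
  · simp_rw [intervalIntegral.integral_const_mul]
  · intro j _
    have h1 := h.continuous_profile
    exact (((h1.sub continuous_const).inv₀ fun s ↦ sub_ne_zero.mpr (hne j s)).const_smul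
      ((m + n * e j) / rootProduct e j)).intervalIntegrable _ _

/-- The integral of an expression in `e^u` over the common denominator: the part that is odd under
the reflection of the period drops out. -/
lemma integral_div_betaDenom (h : IsEquivariantMetric u ψ β)
    (hR : L.IsRectangular ω τ e₁ e₂ (profile u β 0)) (hLg₂ : L.g₂ = (4 / 3 * β ^ 2 : ℝ))
    (hlam : ‖lam‖ = 1) {e : Fin 3 → ℝ} (he : Function.Injective e)
    (hI : (hopfCoeff ψ lam).im ≠ 0)
    (hprod : ∀ s, ∏ j, (profile u β s - e j) =
      (Real.exp (u s) * deriv u s) ^ 2 + 4 * (hopfCoeff ψ lam).im ^ 2) (m n : ℝ) :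
    ∫ s in (0 : ℝ)..(2 * ω), ((m + n * profile u β s : ℝ) : ℂ) * (betaDenom u ψ lam s)⁻¹ =
      2 * Complex.I * (hopfCoeff ψ lam).im * ∑ j, ((m + n * e j) / rootProduct e j : ℝ) *
        ((∫ s in (0 : ℝ)..(2 * ω), (profile u β s - e j)⁻¹ : ℝ) : ℂ) := by
  have hne := profile_ne hI hprod
  have hq : ∀ s, (Real.exp (u s) * deriv u s) ^ 2 + 4 * (hopfCoeff ψ lam).im ^ 2 ≠ 0 := fun s ↦ by
    positivity
  have c1 := h.continuous_exp
  have c2 := h.continuous_deriv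
  have c3 := h.continuous_profile
  -- The first summand carries the factor `e^u u'` and is odd under `s ↦ 2ω - s`; the second is the
  -- rational function of `p` to be decomposed.
  have hsplit : ∀ s, ((m + n * profile u β s : ℝ) : ℂ) * (betaDenom u ψ lam s)⁻¹ =
      ((-(m + n * profile u β s) * (Real.exp (u s) * deriv u s) /
        ((Real.exp (u s) * deriv u s) ^ 2 + 4 * (hopfCoeff ψ lam).im ^ 2) : ℝ) : ℂ) +
      2 * Complex.I * (hopfCoeff ψ lam).im *
        (((m + n * profile u β s) / ∏ j, (profile u β s - e j) : ℝ) : ℂ) := by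
    intro s
    rw [inv_betaDenom hlam hI, hprod]
    push_cast
    ring
  have i1 : Continuous fun s ↦ -(m + n * profile u β s) * (Real.exp (u s) * deriv u s) /
        ((Real.exp (u s) * deriv u s) ^ 2 + 4 * (hopfCoeff ψ lam).im ^ 2) :=
    Continuous.div (by fun_prop) (by fun_prop) hq
  have i2 : Continuous fun s ↦ (m + n * profile u β s) / ∏ j, (profile u β s - e j) := by
    simp_rw [hprod]
    exact Continuous.div (by fun_prop) (by fun_prop) hq
  have j1 := (Complex.continuous_ofReal.comp i1).intervalIntegrable (μ := volume) 0 (2 * ω)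
  have j2 := ((Complex.continuous_ofReal.comp i2).const_smul
    (2 * Complex.I * (hopfCoeff ψ lam).im)).intervalIntegrable (μ := volume) 0 (2 * ω)
  simp only [Function.comp_def] at j1
  simp only [Function.comp_def, Pi.smul_def, smul_eq_mul] at j2
  simp_rw [hsplit]
  rw [intervalIntegral.integral_add j1 j2,
    intervalIntegral.integral_const_mul, intervalIntegral.integral_ofReal,
    intervalIntegral.integral_ofReal, h.integral_linear_div he hne,
    intervalIntegral_eq_zero_of_reflect_neg fun s ↦ ?_]
  · push_cast
    ring
  · rw [h.profile_reflect hR hLg₂, h.exp_mul_deriv_reflect hR hLg₂]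
    ring

end Integrals

end IsEquivariantMetric

/-! ### Principal values for real `λ⁻³ψ` -/

lemma mem_thickening_reflect {S : Set ℝ} {c : ℝ} (hS : ∀ s ∈ S, c - s ∈ S) {ε s : ℝ}
    (hs : s ∈ Metric.thickening ε S) : c - s ∈ Metric.thickening ε S := by
  obtain ⟨z, hz, hd⟩ := Metric.mem_thickening_iff.mp hs
  refine Metric.mem_thickening_iff.mpr ⟨c - z, hS z hz, ?_⟩
  rwa [dist_sub_left]

lemma setIntegral_eq_zero_of_reflect_neg {f : ℝ → ℂ} {A : Set ℝ} {c : ℝ}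
    (hA : ∀ s ∈ A, c - s ∈ A) (hf : ∀ s, f (c - s) = -f s) : ∫ s in A, f s = 0 := by
  have hpre : (fun s ↦ c - s) ⁻¹' A = A := by
    ext s
    exact ⟨fun hs ↦ by simpa using hA _ hs, fun hs ↦ hA s hs⟩
  have h1 := (Measure.measurePreserving_sub_left volume c).setIntegral_preimage_emb
    (MeasurableEquiv.subLeft c).measurableEmbedding f A
  rw [hpre] at h1
  simp only [hf, integral_neg] at h1
  exact self_eq_neg.mp h1.symm

lemma isCompact_Icc_diff_thickening (a b ε : ℝ) (S : Set ℝ) :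
    IsCompact (Set.Icc a b \ Metric.thickening ε S) :=
  isCompact_Icc.diff Metric.isOpen_thickening

lemma tendsto_volume_Icc_diff_thickening {a b : ℝ} (hab : a ≤ b) {S : Set ℝ} (hS : S.Finite) :
    Tendsto (fun ε ↦ volume.real (Set.Icc a b \ Metric.thickening ε S)) (𝓝[>] 0) (𝓝 (b - a)) := by
  have hfin : ∀ ε, volume (Metric.thickening ε S) ≠ ⊤ := fun ε ↦
    (hS.isBounded.thickening).measure_lt_top.ne
  have h1 := tendsto_measure_thickening_of_isClosed (μ := volume) ⟨1, one_pos, hfin 1⟩ hS.isClosed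
  rw [hS.measure_zero] at h1
  have h2 : Tendsto (fun ε ↦ volume.real (Metric.thickening ε S)) (𝓝[>] 0) (𝓝 0) :=
    (ENNReal.tendsto_toReal ENNReal.zero_ne_top).comp h1
  have hv : volume.real (Set.Icc a b) = b - a := by simp [measureReal_def, hab]
  refine tendsto_of_tendsto_of_tendsto_of_le_of_le
    (by simpa using (tendsto_const_nhds (x := b - a)).sub h2) tendsto_const_nhds ?_ ?_
  · intro ε
    rw [← hv]
    exact le_measureReal_sdiff (h := hfin ε)
  · intro ε
    rw [← hv]
    exact measureReal_mono Set.sdiff_subset (by simp)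

/-- With `d_j = -2R/D_j`, these are the Vieta relations identifying the `i d_j` as the roots of `x³
+ βx - 2iR`. -/
lemma inv_roots {D : Fin 3 → ℝ} {β R : ℝ} (hD : ∀ j, D j ≠ 0) (s1 : D 0 + D 1 + D 2 = -β)
    (s2 : D 0 * D 1 + D 0 * D 2 + D 1 * D 2 = 0) (s3 : D 0 * D 1 * D 2 = 4 * R ^ 2) (hR : R ≠ 0) :
    -2 * R / D 0 + -2 * R / D 1 + -2 * R / D 2 = 0 ∧
    -2 * R / D 0 * (-2 * R / D 1) + -2 * R / D 0 * (-2 * R / D 2) +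
      -2 * R / D 1 * (-2 * R / D 2) = -β ∧
    -2 * R / D 0 * (-2 * R / D 1) * (-2 * R / D 2) = -2 * R := by
  have h0 := hD 0
  have h1 := hD 1
  have h2 := hD 2
  refine ⟨?_, ?_, ?_⟩
  · field_simp
    linear_combination -2 * R * s2
  · rw [← s1]
    field_simp
    linear_combination (-(D 0 + D 1 + D 2)) * s3
  · field_simp
    linear_combination s3

namespace IsEquivariantMetric

variable {u : ℝ → ℝ} {ψ lam : ℂ} {β : ℝ} {ω τ e₁ e₂ : ℝ} {L : PeriodPair}

/-- On the line through `iτ`, `℘'` equals `-2 e^u u'`. Its zeros are isolated, and a compact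
discrete set is finite. -/
lemma finite_zeros (h : IsEquivariantMetric u ψ β)
    (hR : L.IsRectangular ω τ e₁ e₂ (profile u β 0)) (hLg₂ : L.g₂ = (4 / 3 * β ^ 2 : ℝ)) (b : ℝ) :
    {s | s ∈ Set.Icc 0 b ∧ Real.exp (u s) * deriv u s = 0}.Finite := by
  have c1 := h.continuous_exp
  have c2 := h.continuous_deriv
  have hder : ∀ s : ℝ, L.derivWeierstrassP (Complex.I * τ + s) =
      (-2 * (Real.exp (u s) * deriv u s) : ℝ) := by
    intro s
    have h1 : HasDerivAt (fun t : ℝ ↦ L.weierstrassP (Complex.I * τ + t))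
        (L.derivWeierstrassP (Complex.I * τ + s)) s :=
      ((L.hasDerivAt_weierstrassP (hR.notMem_horizontal s)).comp_const_add _ _).comp_ofReal
    simp only [h.weierstrassP_eq_profile hR hLg₂] at h1
    exact h1.unique (h.hasDerivAt_profile s).ofReal_comp
  refine IsCompact.finite ?_ ?_
  · exact isCompact_Icc.inter_right (isClosed_eq (c1.mul c2) continuous_const)
  · rw [isDiscrete_iff_nhdsNE]
    intro s _
    have ht : Tendsto (fun t : ℝ ↦ Complex.I * τ + t) (𝓝[≠] s) (𝓝[≠] (Complex.I * τ + s)) := by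
      refine tendsto_nhdsWithin_iff.mpr ⟨?_, ?_⟩
      · exact (show Continuous fun t : ℝ ↦ Complex.I * τ + t by
          fun_prop).continuousAt.tendsto.mono_left nhdsWithin_le_nhds
      · filter_upwards [self_mem_nhdsWithin] with t ht
        simpa using ht
    have h2 := ht.eventually
      (L.eventually_derivWeierstrassP_ne_zero (hR.notMem_horizontal s))
    rw [← disjoint_iff, disjoint_principal_right]
    filter_upwards [h2] with t ht' hts
    refine ht' ?_
    rw [hder, hts.2]
    simp

lemma betaDenom_eq_of_im_eq_zero (hlam : ‖lam‖ = 1) (hI : (hopfCoeff ψ lam).im = 0) (s : ℝ) :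
    betaDenom u ψ lam s = -(Real.exp (u s) * deriv u s : ℝ) := by
  rw [betaDenom_eq hlam, hI]
  simp

/-- For real `λ⁻³ψ` the principal value of an even function over the common denominator
vanishes. -/
lemma hasPrincipalValue_div_betaDenom (h : IsEquivariantMetric u ψ β)
    (hR : L.IsRectangular ω τ e₁ e₂ (profile u β 0)) (hLg₂ : L.g₂ = (4 / 3 * β ^ 2 : ℝ))
    (hlam : ‖lam‖ = 1) (hI : (hopfCoeff ψ lam).im = 0) (a : ℂ) {f g : ℝ → ℂ} (hg : Continuous g)
    (hg' : ∀ s, g (2 * ω - s) = g s)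
    (hf : ∀ s, betaDenom u ψ lam s ≠ 0 → f s = a + g s / betaDenom u ψ lam s) :
    HasPrincipalValue f 0 (2 * ω) {s | s ∈ Set.Icc 0 (2 * ω) ∧ betaDenom u ψ lam s = 0}
      (2 * ω * a) := by
  set S : Set ℝ := {s | s ∈ Set.Icc 0 (2 * ω) ∧ betaDenom u ψ lam s = 0} with hSdef
  have hden := fun s ↦ betaDenom_eq_of_im_eq_zero (u := u) hlam hI s
  have hrefl : ∀ s, betaDenom u ψ lam (2 * ω - s) = -betaDenom u ψ lam s := fun s ↦ by
    rw [hden, hden, h.exp_mul_deriv_reflect hR hLg₂]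
    push_cast
    rfl
  have hSr : ∀ s ∈ S, 2 * ω - s ∈ S := fun s hs ↦
    ⟨⟨by linarith [hs.1.2], by linarith [hs.1.1]⟩, by rw [hrefl, hs.2, neg_zero]⟩
  have hSfin : S.Finite := by
    refine (h.finite_zeros hR hLg₂ (2 * ω)).subset fun s hs ↦ ⟨hs.1, ?_⟩
    have := hs.2
    rw [hden] at this
    exact_mod_cast neg_eq_zero.mp this
  have hne : ∀ ε > 0, ∀ s ∈ Set.Icc 0 (2 * ω) \ Metric.thickening ε S, betaDenom u ψ lam s ≠ 0 :=
    fun ε hε s hs h0 ↦ hs.2 (Metric.self_subset_thickening hε S ⟨hs.1, h0⟩)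
  have hcont : ∀ ε > 0, ContinuousOn (fun s ↦ g s / betaDenom u ψ lam s)
      (Set.Icc 0 (2 * ω) \ Metric.thickening ε S) := fun ε hε ↦
    hg.continuousOn.div h.continuous_betaDenom.continuousOn (hne ε hε)
  have hmeas : ∀ ε, MeasurableSet (Set.Icc 0 (2 * ω) \ Metric.thickening ε S) := fun ε ↦
    (isCompact_Icc_diff_thickening _ _ _ _).measurableSet
  have hint : ∀ ε > 0, IntegrableOn (fun s ↦ g s / betaDenom u ψ lam s)
      (Set.Icc 0 (2 * ω) \ Metric.thickening ε S) := fun ε hε ↦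
    (hcont ε hε).integrableOn_compact (isCompact_Icc_diff_thickening _ _ _ _)
  have hconst : ∀ ε > 0, IntegrableOn (fun _ ↦ a)
      (Set.Icc 0 (2 * ω) \ Metric.thickening ε S) := fun ε hε ↦
    continuousOn_const.integrableOn_compact (isCompact_Icc_diff_thickening _ _ _ _)
  have hEq : ∀ ε > 0, Set.EqOn f (fun s ↦ a + g s / betaDenom u ψ lam s)
      (Set.Icc 0 (2 * ω) \ Metric.thickening ε S) := fun ε hε s hs ↦ hf s (hne ε hε s hs)
  refine ⟨fun ε hε ↦ (integrableOn_congr_fun (hEq ε hε) (hmeas ε)).mpr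
    ((hconst ε hε).add (hint ε hε)), ?_⟩
  -- The truncated interval is symmetric, so the odd quotient integrates to zero for every `ε`,
  -- before any limit; only the measure times `a` remains.
  have hval : ∀ ε > 0, ∫ s in Set.Icc 0 (2 * ω) \ Metric.thickening ε S, f s =
      (volume.real (Set.Icc 0 (2 * ω) \ Metric.thickening ε S) : ℂ) * a := by
    intro ε hε
    rw [setIntegral_congr_fun (hmeas ε) (hEq ε hε), integral_add (hconst ε hε) (hint ε hε),
      setIntegral_eq_zero_of_reflect_neg (c := 2 * ω) (f := fun s ↦ g s / betaDenom u ψ lam s),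
      setIntegral_const, add_zero, Complex.real_smul]
    · exact fun s hs ↦ ⟨⟨by linarith [hs.1.2], by linarith [hs.1.1]⟩, fun h' ↦ hs.2 (by
        simpa using mem_thickening_reflect hSr h')⟩
    · intro s
      rw [hg', hrefl, div_neg]
  have ht := tendsto_volume_Icc_diff_thickening (a := 0) (b := 2 * ω)
    (by linarith [hR.pos_left]) hSfin
  have ht' := ((Complex.continuous_ofReal.tendsto _).comp ht).mul_const a
  refine Tendsto.congr' ?_ (by simpa using ht')
  filter_upwards [self_mem_nhdsWithin] with ε hε
  exact (hval ε hε).symm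

end IsEquivariantMetric

end

/-! ### The period formulas -/

open IsEquivariantMetric in
theorem mainTheorem2
    (u : ℝ → ℝ) (ψ : ℂ) (β : ℝ) (hu : IsEquivariantMetric u ψ β)
    (lam : ℂ) (hlam : ‖lam‖ = 1)
    (ω τ : ℝ) (hω : 0 < ω) (hτ : 0 < τ)
    (L : PeriodPair) (hL₁ : L.ω₁ = 2 * ω) (hL₂ : L.ω₂ = 2 * (Complex.I * τ))
    (g₂ g₃ : ℝ) (hg₂ : g₂ = 4 / 3 * β ^ 2) (hg₃ : g₃ = 16 * ‖ψ‖ ^ 2 - 8 / 27 * β ^ 3)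
    (hLg₂ : L.g₂ = g₂) (hLg₃ : L.g₃ = g₃) :
    ((hopfCoeff ψ lam).im ≠ 0 → (hopfCoeff ψ lam).re ≠ 0 →
      ∃ e d : Fin 3 → ℝ,
        StrictAnti e ∧
        (∀ x : ℂ, 4 * x ^ 3 - g₂ * x - (g₃ - 16 * (hopfCoeff ψ lam).im ^ 2 : ℝ)
          = 4 * ∏ j, (x - e j)) ∧
        (potentialMatrix u ψ lam).charpoly
          = ∏ j, (Polynomial.X - Polynomial.C (Complex.I * (d j : ℂ))) ∧
        (∀ j, e j = β / 3 + d (j + 1) * d (j + 2)) ∧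
        (∀ j, ∃ α : ℂ, α ∉ L.lattice ∧ |α.im| < τ ∧ L.weierstrassP α = e j) ∧
        IntervalIntegrable (betaOneIntegrand u ψ lam) MeasureTheory.volume 0 (2 * ω) ∧
        IntervalIntegrable (betaTwoIntegrand u ψ lam) MeasureTheory.volume 0 (2 * ω) ∧
        (∀ j, IntervalIntegrable (phaseIntegrand u ψ lam (d j)) MeasureTheory.volume
          0 (2 * ω)) ∧
        ∀ α : Fin 3 → ℂ,
          (∀ j, α j ∉ L.lattice ∧ |(α j).im| < τ ∧ L.weierstrassP (α j) = e j) →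
          (∀ j, L.derivWeierstrassP (α j) ≠ 0) ∧
          betaOne u ψ lam (2 * ω) = 2 * ω * Complex.I
            - 4 * (hopfCoeff ψ lam).im * (hopfCoeff ψ lam).re
              * ∑ j, 1 / (rootProduct e j : ℂ) * zetaTerm L ω (α j) ∧
          betaTwo u ψ lam (2 * ω) = 2 * Complex.I * (hopfCoeff ψ lam).im
              * ∑ j, ((β / 3 - e j) / rootProduct e j : ℝ) * zetaTerm L ω (α j) ∧
          ∀ j, (phaseG u ψ lam (d j) (2 * ω) : ℂ)
            = -2 * (hopfCoeff ψ lam).im * zetaTerm L ω (α j)) ∧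
    ((hopfCoeff ψ lam).im = 0 →
      HasPrincipalValue (betaOneIntegrand u ψ lam) 0 (2 * ω)
        {s | s ∈ Set.Icc 0 (2 * ω) ∧ betaDenom u ψ lam s = 0} (2 * ω * Complex.I) ∧
      HasPrincipalValue (betaTwoIntegrand u ψ lam) 0 (2 * ω)
        {s | s ∈ Set.Icc 0 (2 * ω) ∧ betaDenom u ψ lam s = 0} 0 ∧
      ∀ d : ℝ, (potentialMatrix u ψ lam).charpoly.IsRoot (Complex.I * d) →
        phaseG u ψ lam d (2 * ω) = 0) := by
  subst hg₂ hg₃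
  obtain ⟨e₁, e₂, hR⟩ := hu.exists_isRectangular hω hτ hL₁ hL₂ hLg₂ hLg₃
  refine ⟨fun hI hre ↦ ?_, fun hI ↦ ⟨?_, ?_, fun d _ ↦ ?_⟩⟩
  · have hnorm := hopfCoeff_re_sq_add_im_sq (ψ := ψ) hlam
    have hI2 : 0 < (hopfCoeff ψ lam).im ^ 2 := by positivity
    -- Since the imaginary part is nonzero, `27 Re(λ⁻³ψ)² < 27‖ψ‖² ≤ β³`, which makes the three
    -- roots real and distinct.
    obtain ⟨D, hanti, hD, s1, s2, s3⟩ := exists_cubic_roots hu.beta_pos hre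
      (by linarith [hu.le_beta_cube])
    set e : Fin 3 → ℝ := fun j ↦ β / 3 + D j with he
    have heanti : StrictAnti e := fun i j hij ↦ add_lt_add_right (hanti hij) _
    have hprod : ∀ s, ∏ j, (profile u β s - e j) =
        (Real.exp (u s) * deriv u s) ^ 2 + 4 * (hopfCoeff ψ lam).im ^ 2 :=
      hu.prod_profile_sub hlam s1 s2 s3
    have hne := profile_ne hI hprod
    have hcubic : ∀ x : ℂ, 4 * x ^ 3 - ((4 / 3 * β ^ 2 : ℝ) : ℂ) * x -
        ((16 * ‖ψ‖ ^ 2 - 8 / 27 * β ^ 3 - 16 * (hopfCoeff ψ lam).im ^ 2 : ℝ) : ℂ) =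
        4 * ∏ j, (x - e j) := by
      intro x
      have s1' : (D 0 + D 1 + D 2 : ℂ) = -β := by exact_mod_cast s1
      have s2' : (D 0 * D 1 + D 0 * D 2 + D 1 * D 2 : ℂ) = 0 := by exact_mod_cast s2
      have s3' : (D 0 * D 1 * D 2 : ℂ) = 4 * (hopfCoeff ψ lam).re ^ 2 := by exact_mod_cast s3
      simp only [he, Complex.ofReal_add, ← sub_sub]
      rw [Fin.prod_three_sub fun j ↦ (D j : ℂ), s1', s2', s3', ← hnorm]
      push_cast
      ring
    have hα' : ∀ (j : Fin 3) (α : ℂ), α ∉ L.lattice → L.weierstrassP α = e j →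
        L.derivWeierstrassP α ^ 2 = ((-16 * (hopfCoeff ψ lam).im ^ 2 : ℝ) : ℂ) := by
      intro j α hα hαe
      have h1 := L.derivWeierstrassP_sq α hα
      have h2 := hcubic (e j)
      rw [Finset.prod_eq_zero (Finset.mem_univ j) (sub_self _)] at h2
      rw [h1, hLg₂, hLg₃, hαe]
      push_cast at h2 ⊢
      linear_combination h2
    have hc0 := hu.continuous_profile
    have hcd := hu.continuous_betaDenom (lam := lam)
    have hd0 := betaDenom_ne_zero (u := u) hlam hI
    have hphase : ∀ j s, phaseIntegrand u ψ lam (-2 * (hopfCoeff ψ lam).re / D j) s =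
        -2 * (hopfCoeff ψ lam).im * (profile u β s - e j)⁻¹ := fun j s ↦
      phaseIntegrand_eq (hD j) hre (hne j s)
    refine ⟨e, fun j ↦ -2 * (hopfCoeff ψ lam).re / D j, heanti, hcubic, ?_, ?_, ?_, ?_, ?_, ?_,
      ?_⟩
    · obtain ⟨t1, t2, t3⟩ := inv_roots hD s1 s2 s3 hre
      have t1' : ((-2 * (hopfCoeff ψ lam).re / D 0 : ℝ) + (-2 * (hopfCoeff ψ lam).re / D 1 : ℝ) +
        (-2 * (hopfCoeff ψ lam).re / D 2 : ℝ) : ℂ) = 0 := by exact_mod_cast t1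
      have t2' : ((-2 * (hopfCoeff ψ lam).re / D 0 : ℝ) * (-2 * (hopfCoeff ψ lam).re / D 1 : ℝ) +
        (-2 * (hopfCoeff ψ lam).re / D 0 : ℝ) * (-2 * (hopfCoeff ψ lam).re / D 2 : ℝ) +
        (-2 * (hopfCoeff ψ lam).re / D 1 : ℝ) * (-2 * (hopfCoeff ψ lam).re / D 2 : ℝ) : ℂ) = -β := by
        exact_mod_cast t2
      have t3' : ((-2 * (hopfCoeff ψ lam).re / D 0 : ℝ) * (-2 * (hopfCoeff ψ lam).re / D 1 : ℝ) *
        (-2 * (hopfCoeff ψ lam).re / D 2 : ℝ) : ℂ) = -2 * (hopfCoeff ψ lam).re := by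
        exact_mod_cast t3
      rw [hu.charpoly_potentialMatrix hlam]
      refine Polynomial.funext fun x ↦ ?_
      rw [Polynomial.eval_prod]
      simp only [Polynomial.eval_add, Polynomial.eval_sub, Polynomial.eval_mul,
        Polynomial.eval_pow, Polynomial.eval_X, Polynomial.eval_C]
      rw [Fin.prod_three_sub fun j ↦ Complex.I * ((-2 * (hopfCoeff ψ lam).re / D j : ℝ) : ℂ)]
      linear_combination (Complex.I * x ^ 2) * t1' + (x * t2') + (Complex.I ^ 3) * t3' -
        (x * ((-2 * (hopfCoeff ψ lam).re / D 0 : ℝ) * (-2 * (hopfCoeff ψ lam).re / D 1 : ℝ) +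
        (-2 * (hopfCoeff ψ lam).re / D 0 : ℝ) * (-2 * (hopfCoeff ψ lam).re / D 2 : ℝ) +
        (-2 * (hopfCoeff ψ lam).re / D 1 : ℝ) * (-2 * (hopfCoeff ψ lam).re / D 2 : ℝ)) +
        2 * Complex.I * (hopfCoeff ψ lam).re) * Complex.I_sq
    · intro j
      have h0 := hD 0
      have h1 := hD 1
      have h2 := hD 2
      simp only [he]
      congr 1
      fin_cases j
      · simp only [Fin.zero_eta, zero_add]
        field_simp
        linear_combination s3
      · simp only [Fin.mk_one, Fin.reduceAdd]
        field_simp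
        linear_combination s3
      · simp only [Fin.reduceFinMk, Fin.reduceAdd]
        field_simp
        linear_combination s3
    · intro j
      have h1 : 4 * (e j - e₁) * (e j - e₂) * (e j - profile u β 0) =
          -16 * (hopfCoeff ψ lam).im ^ 2 := by
        have h2 := hcubic (e j)
        rw [Finset.prod_eq_zero (Finset.mem_univ j) (sub_self _)] at h2
        have h3 := hR.cubic (e j)
        rw [hLg₂, hLg₃] at h3
        push_cast at h2 h3
        have : (4 * (e j - e₁) * (e j - e₂) * (e j - profile u β 0) : ℂ) =
          -16 * (hopfCoeff ψ lam).im ^ 2 := by linear_combination h2 - h3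
        exact_mod_cast this
      -- The strict sign excludes the values `e₁`, `e₂`, `e₃`, so a preimage lies strictly inside
      -- the strip `|Im α| < τ`.
      have h2 : 4 * (e j - e₁) * (e j - e₂) * (e j - profile u β 0) ≠ 0 := by
        rw [h1]; linarith
      simp only [mul_ne_zero_iff, sub_ne_zero] at h2
      obtain ⟨⟨⟨-, h3⟩, h4⟩, h5⟩ := h2
      obtain ⟨h6, h7 | h7⟩ := cubic_nonpos_iff_gap hR.lt₁ hR.lt₂ (by rw [h1]; linarith)
      · exact hR.exists_weierstrassP_eq_of_lt (lt_of_le_of_ne h7 h5)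
      · exact hR.exists_weierstrassP_eq_of_mem_Ioo
          ⟨lt_of_le_of_ne h7 h4.symm, lt_of_le_of_ne h6 h3⟩
    · exact (hu.continuous_betaOneIntegrand_num.div hcd hd0).intervalIntegrable _ _
    · exact (hu.continuous_betaTwoIntegrand_num.div hcd hd0).intervalIntegrable _ _
    · intro j
      refine Continuous.intervalIntegrable ?_ _ _
      simp_rw [funext (hphase j)]
      exact continuous_const.mul
        ((hc0.sub continuous_const).inv₀ fun s ↦ sub_ne_zero.mpr (hne j s))
    · intro α hα
      have hder : ∀ j, L.derivWeierstrassP (α j) ≠ 0 := by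
        intro j h0
        have h1 := hα' j (α j) (hα j).1 (hα j).2.2
        rw [h0] at h1
        exact hI (by simpa using h1)
      have hz : ∀ j, ((∫ s in (0 : ℝ)..(2 * ω), (profile u β s - e j)⁻¹ : ℝ) : ℂ) =
          zetaTerm L ω (α j) := fun j ↦
        hu.integral_inv_profile_sub hR hLg₂ (hα j).2.1 (hder j) (hα j).2.2
      have key := hu.integral_div_betaDenom hR hLg₂ hlam heanti.injective hI hprod
      simp only [hz] at key
      refine ⟨hder, ?_, ?_, fun j ↦ ?_⟩
      -- The case `m = 1`, `n = 0` of the linear numerator; `β₂` uses `2e^u = β/3 - p`.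
      · have h1 : ∀ s, betaOneIntegrand u ψ lam s = Complex.I + 2 * Complex.I *
            (hopfCoeff ψ lam).re * (((1 + 0 * profile u β s : ℝ) : ℂ) *
              (betaDenom u ψ lam s)⁻¹) := fun s ↦ by
          rw [betaOneIntegrand_eq hlam u (hd0 s)]
          simp [div_eq_mul_inv]
        have h2 : Continuous fun s ↦ 2 * Complex.I *
            (hopfCoeff ψ lam).re * (((1 + 0 * profile u β s : ℝ) : ℂ) *
              (betaDenom u ψ lam s)⁻¹) := by
          have := hcd.inv₀ hd0
          fun_prop
        rw [betaOne]
        simp_rw [h1]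
        rw [intervalIntegral.integral_add intervalIntegrable_const (h2.intervalIntegrable _ _),
          intervalIntegral.integral_const_mul, key, intervalIntegral.integral_const]
        simp only [zero_mul, add_zero, sub_zero, Complex.real_smul, Complex.ofReal_div,
          Complex.ofReal_one]
        push_cast
        linear_combination (4 * (hopfCoeff ψ lam).im * (hopfCoeff ψ lam).re *
          ∑ j, 1 / (rootProduct e j : ℂ) * zetaTerm L ω (α j)) * Complex.I_sq
      · have h1 : ∀ s, betaTwoIntegrand u ψ lam s =
            ((β / 3 + (-1) * profile u β s : ℝ) : ℂ) * (betaDenom u ψ lam s)⁻¹ := fun s ↦ by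
          rw [betaTwoIntegrand, div_eq_mul_inv, profile]
          congr 2
          ring
        rw [betaTwo]
        simp_rw [h1]
        rw [key]
        simp only [neg_one_mul, ← sub_eq_add_neg]
      · rw [phaseG]
        simp_rw [hphase]
        rw [intervalIntegral.integral_const_mul, Complex.ofReal_mul, hz]
        push_cast
        rfl
  · refine hu.hasPrincipalValue_div_betaDenom hR hLg₂ hlam hI Complex.I
      (g := fun _ ↦ 2 * Complex.I * (hopfCoeff ψ lam).re) continuous_const (fun _ ↦ rfl)
      fun s hs ↦ betaOneIntegrand_eq hlam u hs
  · have := hu.hasPrincipalValue_div_betaDenom hR hLg₂ hlam hI 0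
      hu.continuous_betaTwoIntegrand_num (fun s ↦ by rw [hu.exp_reflect hR hLg₂])
      (f := betaTwoIntegrand u ψ lam) fun s _ ↦ by rw [zero_add, betaTwoIntegrand]
    simpa using this
  -- The numerator is identically zero, so the integrand vanishes even where the denominator does.
  · simp [phaseG, phaseIntegrand, hI]
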